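/- **Theorem (Correctness of constructive ALBA).** *Language and algebras.* Let $\mathcal F,\mathcal G$ be disjoint sets of connectives; each $h$ has an arity $n_h\in\mathbb N$, an order-type $\varepsilon_h\in\{1,\partial\}^{n_h}$, and is either normal or regular, regular connectives being unary. $\mathcal L_{\mathrm{LE}}$-formulas are built from countably many proposition letters with $\bot,\top,\wedge,\vee$ and the connectives in $\mathcal F\cup\mathcal G$. For a lattice $X$ let $X^1=X$, let $X^\partial$ be its dual, and $X^{\varepsilon}=\prod_iX^{\varepsilon(i)}$. An $\mathcal L_{\mathrm{LE}}$-algebra $\mathbb A$ is a bounded lattice $A$ with operations $f^{\mathbb A}:A^{\varepsilon_f}\to A$ $(f\in\mathcal F)$ preserving binary joins in each coordinate, and $g^{\mathbb A}:A^{\varepsilon_g}\to A$ $(g\in\mathcal G)$ preserving binary meets in each coordinate; those of normal connectives moreover preserve the empty join (resp. the empty meet) in each coordinate. *Canonical extension.* $A^\delta$ is a complete lattice containing $A$ as a bounded sublattice such that every element is a join of closed elements (meets of subsets of $A$) and a meet of open elements (joins of subsets of $A$), and such that whenever $S,T\subseteq A$ and $\bigwedge S\le\bigvee T$, there are finite $S'\subseteq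 S$, $T'\subseteq T$ with $\bigwedge S'\le\bigvee T'$. Let $K$ and $O$ be the sets of closed and of open elements. $\mathbb A^\delta$ is $A^\delta$ with each $f\in\mathcal F$ interpreted by the $\sigma$-extension and each $g\in\mathcal G$ by the $\pi$-extension: with $\le^{\varepsilon}$ the order of $(A^\delta)^{\varepsilon}$, and $K^{\varepsilon}$ (resp. $O^{\varepsilon}$) the set of tuples $u$ with $u_i$ closed (resp. open) if $\varepsilon(i)=1$ and open (resp. closed) if $\varepsilon(i)=\partial$, $$f^\sigma(u)=\bigvee\Big\{\bigwedge\{f(a)\mid a\in A^{n_f},\,k\le^{\varepsilon_f}a\}\ \Big|\ k\in K^{\varepsilon_f},\,k\le^{\varepsilon_f}u\Big\},$$ $$g^\pi(u)=\bigwedge\Big\{\bigvee\{g(a)\mid a\in A^{n_g},\,a\le^{\varepsilon_g}o\}\ \Big|\ o\in O^{\varepsilon_g},\,u\le^{\varepsilon_g}o\Big\}.$$ *Expanded language.* $\mathcal L_{\mathrm{LE}}^+$ adds countably many nominals $\mathbf j$ and co-nominals $\mathbf m$, and connectives interpreted on $\mathbb A^\delta$ as follows. (a) For regular $f\in\mathcal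 F$ its normalization, which sends the bottom of $(A^\delta)^{\varepsilon_f}$ to $\bot$ and agrees with $f$ elsewhere; for regular $g\in\mathcal G$ its normalization, which sends the top of $(A^\delta)^{\varepsilon_g}$ to $\top$ and agrees with $g$ elsewhere. (b) For $f\in\mathcal F$ and $1\le i\le n_f$, writing $\hat f$ for $f$ if $f$ is normal and for its normalization if $f$ is regular, the connective $f^\sharp_i$: $f^\sharp_i(a_1,\dots,b,\dots,a_{n_f})$ with $b$ in place $i$ is $\bigvee\{c\mid\hat f(a_1,\dots,c,\dots,a_{n_f})\le b\}$ if $\varepsilon_f(i)=1$, and the meet of the same set if $\varepsilon_f(i)=\partial$. (c) For $g\in\mathcal G$, with $\hat g$ defined likewise, the connective $g^\flat_i$: $g^\flat_i(a_1,\dots,b,\dots,a_{n_g})$ is $\bigwedge\{c\mid b\le\hat g(a_1,\dots,c,\dots,a_{n_g})\}$ if $\varepsilon_g(i)=1$, and the join of the same set if $\varepsilon_g(i)=\partial$. The normalizations have the order-types of $f,g$. The order-type of $f^\sharp_i$ is $\varepsilon_f$ if $\varepsilon_f(i)=\partial$; if $\varepsilon_f(i)=1$ it is $1$ at $i$ and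 opposite to $\varepsilon_f$ elsewhere; likewise for $g^\flat_i$. The normalizations of the $f$'s, the $f^\sharp_i$ with $\varepsilon_f(i)=\partial$ and the $g^\flat_i$ with $\varepsilon_g(i)=1$ count with $\mathcal F$ as connectives of $\mathcal F^*$, the remaining new ones with $\mathcal G$ as connectives of $\mathcal G^*$. An assignment maps proposition letters to arbitrary elements of $A^\delta$, nominals into $K$, co-nominals into $O$. $\mathbb A^\delta\models\varphi\le\psi$ means that $\varphi\le\psi$ holds under all assignments. A system $(S,\mathsf{Ineq})$, with $S$ a finite set of $\mathcal L^+_{\mathrm{LE}}$-inequalities and $\mathsf{Ineq}$ one such inequality, stands for the quasi-inequality $\&S\Rightarrow\mathsf{Ineq}$; $\mathbb A^\delta$ validates it if $\mathsf{Ineq}$ holds under every assignment under which all members of $S$ hold. It is pure if it contains no proposition letter. *Signs.* In the generation tree $+s$ (resp. $-s$) the root has sign $+$ (resp. $-$); children of $\wedge,\vee$ inherit the sign, and the $i$th child of a connective $h$ inherits it if $\varepsilon_h(i)=1$ and gets the opposite one if $\varepsilon_h(i)=\partial$. $s$ is positive (negative) in $p$ if all occurrences of $p$ in $+s$ have sign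 $+$ ($-$). A branch from a leaf to the root is SAC if all its nodes other than the leaf are of the form $+f$ ($f\in\mathcal F^*$) or $-g$ ($g\in\mathcal G^*$). $\phi(!x)$ denotes a formula with exactly one occurrence of $x$. *ALBA.* **Stage 1** starts from the set $\{\varphi\le\psi\}$ and applies the following rules to members of the set any number of times and in any order (in particular, exhaustively). (i) *Elimination:* replace $\alpha\le\beta$ by $\alpha(\bot/p)\le\beta(\bot/p)$ if $\alpha$ is negative and $\beta$ positive in $p$; by $\alpha(\top/p)\le\beta(\top/p)$ if $\alpha$ is positive and $\beta$ negative in $p$. (ii) *Distribution,* inside $+\alpha$ or $-\beta$: at a node $+f$, replace $f(\dots,s\vee t,\dots)$ (coordinate with $\varepsilon_f(i)=1$) or $f(\dots,s\wedge t,\dots)$ ($\varepsilon_f(i)=\partial$) by $f(\dots,s,\dots)\vee f(\dots,t,\dots)$; at a node $-g$, replace $g(\dots,s\wedge t,\dots)$ ($\varepsilon_g(i)=1$) or $g(\dots,s\vee t,\dots)$ ($\varepsilon_g(i)=\partial$) by $g(\dots,s,\dots)\wedge g(\dots,t,\dots)$. (iii) *Splitting:* replace $\alpha\le\beta\wedge\gamma$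 by $\alpha\le\beta$ and $\alpha\le\gamma$; replace $\alpha\vee\beta\le\gamma$ by $\alpha\le\gamma$ and $\beta\le\gamma$. **Stage 2** transforms, for each resulting $\varphi_i\le\psi_i$, the system $(\varnothing,\varphi_i\le\psi_i)$ by any finite sequence of the following rules. * *Approximation* (where $\gamma\in\mathcal L_{\mathrm{LE}}$, and $\mathbf j$, $\mathbf m$ are the first nominal and co-nominal not occurring in the system). If the branch of $+\phi'(!x)$ ending in $x$ is SAC, then $(S,\phi'(\gamma)\le\psi)$ becomes $(S\cup\{\mathbf j\le\gamma\},\phi'(\mathbf j)\le\psi)$ if $x$ has sign $+$ there, and $(S\cup\{\gamma\le\mathbf m\},\phi'(\mathbf m)\le\psi)$ if $x$ has sign $-$. If the branch of $-\psi'(!x)$ ending in $x$ is SAC, then $(S,\phi\le\psi'(\gamma))$ becomes $(S\cup\{\mathbf j\le\gamma\},\phi\le\psi'(\mathbf j))$ if $x$ has sign $+$ there, and $(S\cup\{\gamma\le\mathbf m\},\phi\le\psi'(\mathbf m))$ if $x$ has sign $-$. * *Residuation,* replacing a member of $S$. For normal $f\in\mathcal F$: $f(\phi_1,\dots,\phi_n)\le\psi$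 is replaced by $\phi_i\le f^\sharp_i(\phi_1,\dots,\psi,\dots,\phi_n)$ if $\varepsilon_f(i)=1$, by $f^\sharp_i(\phi_1,\dots,\psi,\dots,\phi_n)\le\phi_i$ if $\varepsilon_f(i)=\partial$. For normal $g\in\mathcal G$: $\psi\le g(\phi_1,\dots,\phi_n)$ is replaced by $g^\flat_i(\phi_1,\dots,\psi,\dots,\phi_n)\le\phi_i$ if $\varepsilon_g(i)=1$, by $\phi_i\le g^\flat_i(\phi_1,\dots,\psi,\dots,\phi_n)$ if $\varepsilon_g(i)=\partial$. For regular $f$: $f(\phi)\le\psi$ is replaced by the pair $f(\bot)\le\psi,\ \phi\le f^\sharp_1(\psi)$ if $\varepsilon_f=1$, and by $f(\top)\le\psi,\ f^\sharp_1(\psi)\le\phi$ if $\varepsilon_f=\partial$. For regular $g$: $\phi\le g(\psi)$ is replaced by the pair $\phi\le g(\top),\ g^\flat_1(\phi)\le\psi$ if $\varepsilon_g=1$, and by $\phi\le g(\bot),\ \psi\le g^\flat_1(\phi)$ if $\varepsilon_g=\partial$. * *Splitting,* as in (iii), of a member of $S$. * *Right Ackermann rule:* $(\{\alpha_i\le p\}_{i\le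 n}\cup\{\beta_j\le\gamma_j\}_{j\le m},\mathsf{Ineq})$ becomes $(\{\beta_j(\alpha/p)\le\gamma_j(\alpha/p)\}_{j\le m},\mathsf{Ineq})$ with $\alpha=\bigvee_{i\le n}\alpha_i$, provided that the letter $p$ does not occur in any $\alpha_i$ or in $\mathsf{Ineq}$, all $\beta_j$ are positive and all $\gamma_j$ negative in $p$. *Left Ackermann rule:* $(\{p\le\alpha_i\}_{i\le n}\cup\{\beta_j\le\gamma_j\}_{j\le m},\mathsf{Ineq})$ becomes $(\{\beta_j(\alpha/p)\le\gamma_j(\alpha/p)\}_{j\le m},\mathsf{Ineq})$ with $\alpha=\bigwedge_{i\le n}\alpha_i$, provided that $p$ does not occur in any $\alpha_i$ or in $\mathsf{Ineq}$, all $\beta_j$ are negative and all $\gamma_j$ positive in $p$. (Empty joins and meets are $\bot$ and $\top$.) ALBA *succeeds* on $\varphi\le\psi$ if some execution reaches a pure system from every $(\varnothing,\varphi_i\le\psi_i)$; then $\mathsf{ALBA}(\varphi\le\psi)$ is the conjunction of the resulting pure quasi-inequalities. *Claim.* For every $\mathcal L_{\mathrm{LE}}$-algebra $\mathbb A$ with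 canonical extension $\mathbb A^\delta$, and every execution of ALBA that succeeds on an $\mathcal L_{\mathrm{LE}}$-inequality $\varphi\le\psi$ and yields $\mathsf{ALBA}(\varphi\le\psi)$, $$\mathbb A^\delta\models\varphi\le\psi\quad\text{iff}\quad\mathbb A^\delta\models\mathsf{ALBA}(\varphi\le\psi).$$ -/

import Mathlib

/-! # Constructive ALBA for normal and regular lattice expansions -/

universe u v w

namespace ALBA

/-! ## Order-types and signs -/

/-- `pos` is the entry `1` of an order-type (or the sign `+` of a node), `neg` is `∂` (or `-`). -/
inductive Pol where
  | pos
  | neg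
  deriving DecidableEq

namespace Pol

/-- The opposite entry. -/
def dual : Pol → Pol
  | pos => neg
  | neg => pos

/-- The sign of the child at a coordinate of order-type `ε` of a node signed `s`. -/
def child (s ε : Pol) : Pol :=
  match ε with
  | pos => s
  | neg => s.dual

/-- The order of `X^ε`. -/
def le {X : Type*} [LE X] : Pol → X → X → Prop
  | pos, x, y => x ≤ y
  | neg, x, y => y ≤ x

/-- The binary join of `X^ε`. -/
def join {X : Type*} [Lattice X] : Pol → X → X → X
  | pos, x, y => x ⊔ y
  | neg, x, y => x ⊓ y

/-- The binary meet of `X^ε`. -/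
def meet {X : Type*} [Lattice X] : Pol → X → X → X
  | pos, x, y => x ⊓ y
  | neg, x, y => x ⊔ y

/-- The bottom of `X^ε`. -/
def bot {X : Type*} [LE X] [BoundedOrder X] : Pol → X
  | pos => ⊥
  | neg => ⊤

/-- The top of `X^ε`. -/
def top {X : Type*} [LE X] [BoundedOrder X] : Pol → X
  | pos => ⊤
  | neg => ⊥

end Pol

/-! ## Signatures and lattice expansions -/

/-- The parameters of the language: the sets of connectives `F` and `G`, with arities and
order-types; `regF` and `regG` single out the regular connectives, the others are normal. -/
structure Sig where
  F : Type u
  G : Type u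
  arF : F → ℕ
  arG : G → ℕ
  otF : (f : F) → Fin (arF f) → Pol
  otG : (g : G) → Fin (arG g) → Pol
  regF : F → Prop
  regG : G → Prop
  unaryF : ∀ f, regF f → arF f = 1
  unaryG : ∀ g, regG g → arG g = 1

/-- An interpretation of the connectives as operations on `X`. -/
structure Ops (L : Sig.{u}) (X : Type v) where
  opF : (f : L.F) → (Fin (L.arF f) → X) → X
  opG : (g : L.G) → (Fin (L.arG g) → X) → X

/-- A lattice expansion with underlying bounded lattice `X`: coordinatewise, as maps from
`X^(ε_f)` (from `X^(ε_g)`) to `X`, the operations of `F` preserve binary joins, those of `G`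
preserve binary meets, and the normal ones also preserve the empty join (the empty meet). -/
structure LatticeExpansion (L : Sig.{u}) (X : Type v) [Lattice X] [BoundedOrder X]
    extends Ops L X where
  opF_join : ∀ f i a x y,
    opF f (Function.update a i ((L.otF f i).join x y))
      = opF f (Function.update a i x) ⊔ opF f (Function.update a i y)
  opF_bot : ∀ f, ¬ L.regF f → ∀ i a, opF f (Function.update a i (L.otF f i).bot) = ⊥
  opG_meet : ∀ g i a x y,
    opG g (Function.update a i ((L.otG g i).meet x y))
      = opG g (Function.update a i x) ⊓ opG g (Function.update a i y)
  opG_top : ∀ g, ¬ L.regG g → ∀ i a, opG g (Function.update a i (L.otG g i).top) = ⊤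

/-! ## Canonical extensions -/

section CanonicalExtension

variable {A : Type v} {C : Type w} [Lattice A] [BoundedOrder A] [CompleteLattice C]

/-- Closed elements: meets of sets of elements of `A`. -/
def IsClosedElt (e : BoundedLatticeHom A C) (u : C) : Prop := ∃ S : Set A, u = sInf (e '' S)

/-- Open elements: joins of sets of elements of `A`. -/
def IsOpenElt (e : BoundedLatticeHom A C) (u : C) : Prop := ∃ S : Set A, u = sSup (e '' S)

/-- `e` exhibits the complete lattice `C` as the canonical extension of `A`: it is a bounded
lattice embedding with dense and compact image. -/
structure IsCanonicalExtension (e : BoundedLatticeHom A C) : Prop where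
  injective : Function.Injective e
  dense_join : ∀ u : C, ∃ S : Set C, (∀ k ∈ S, IsClosedElt e k) ∧ u = sSup S
  dense_meet : ∀ u : C, ∃ S : Set C, (∀ o ∈ S, IsOpenElt e o) ∧ u = sInf S
  compact : ∀ S T : Set A, sInf (e '' S) ≤ sSup (e '' T) →
    ∃ S' ⊆ S, ∃ T' ⊆ T, S'.Finite ∧ T'.Finite ∧ sInf (e '' S') ≤ sSup (e '' T')

/-- Membership in `K(C)^ε`. -/
def Pol.IsClosed (e : BoundedLatticeHom A C) : Pol → C → Prop
  | Pol.pos, u => IsClosedElt e u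
  | Pol.neg, u => IsOpenElt e u

/-- Membership in `O(C)^ε`. -/
def Pol.IsOpen (e : BoundedLatticeHom A C) : Pol → C → Prop
  | Pol.pos, u => IsOpenElt e u
  | Pol.neg, u => IsClosedElt e u

/-- The `σ`-extension on tuples of closed elements of `C^ε`. -/
def sigmaClosed (e : BoundedLatticeHom A C) {n : ℕ} (ε : Fin n → Pol)
    (f : (Fin n → A) → A) (k : Fin n → C) : C :=
  sInf {x | ∃ a : Fin n → A, (∀ i, (ε i).le (k i) (e (a i))) ∧ x = e (f a)}

/-- The `σ`-extension. -/
def sigmaExt (e : BoundedLatticeHom A C) {n : ℕ} (ε : Fin n → Pol)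
    (f : (Fin n → A) → A) (u : Fin n → C) : C :=
  sSup {x | ∃ k : Fin n → C, (∀ i, (ε i).IsClosed e (k i)) ∧ (∀ i, (ε i).le (k i) (u i)) ∧
    x = sigmaClosed e ε f k}

/-- The `π`-extension on tuples of open elements of `C^ε`. -/
def piOpen (e : BoundedLatticeHom A C) {n : ℕ} (ε : Fin n → Pol)
    (g : (Fin n → A) → A) (o : Fin n → C) : C :=
  sSup {x | ∃ a : Fin n → A, (∀ i, (ε i).le (e (a i)) (o i)) ∧ x = e (g a)}

/-- The `π`-extension. -/
def piExt (e : BoundedLatticeHom A C) {n : ℕ} (ε : Fin n → Pol)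
    (g : (Fin n → A) → A) (u : Fin n → C) : C :=
  sInf {x | ∃ o : Fin n → C, (∀ i, (ε i).IsOpen e (o i)) ∧ (∀ i, (ε i).le (u i) (o i)) ∧
    x = piOpen e ε g o}

/-- The operations of the canonical extension of a lattice expansion. -/
def canOps {L : Sig.{u}} (𝔸 : LatticeExpansion L A) (e : BoundedLatticeHom A C) : Ops L C where
  opF f := sigmaExt e (L.otF f) (𝔸.opF f)
  opG g := piExt e (L.otG g) (𝔸.opG g)

end CanonicalExtension

/-! ## The tense signature

`F'` consists of the normal connectives of `F` and of the normalizations of the regular ones, so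
it is indexed by `F`: the index `f` stands for `f` itself if `f` is normal, and for its
normalization if `f` is regular. Similarly for `G'`. Accordingly, for regular `f` the residual
`sharp f i` is the adjoint of the normalization of `f`, and dually for `flat g i`. -/

/-- The connectives of `F*`. -/
inductive StarF (L : Sig.{u}) : Type u where
  | base (f : L.F)
  | norm (f : L.F) (h : L.regF f)
  | sharp (f : L.F) (i : Fin (L.arF f)) (h : L.otF f i = Pol.neg)
  | flat (g : L.G) (i : Fin (L.arG g)) (h : L.otG g i = Pol.pos)

/-- The connectives of `G*`. -/
inductive StarG (L : Sig.{u}) : Type u where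
  | base (g : L.G)
  | norm (g : L.G) (h : L.regG g)
  | sharp (f : L.F) (i : Fin (L.arF f)) (h : L.otF f i = Pol.pos)
  | flat (g : L.G) (i : Fin (L.arG g)) (h : L.otG g i = Pol.neg)

/-- The signature of the tense language; the added connectives are all normal. -/
def Sig.star (L : Sig.{u}) : Sig.{u} where
  F := StarF L
  G := StarG L
  arF
    | StarF.base f => L.arF f
    | StarF.norm f _ => L.arF f
    | StarF.sharp f _ _ => L.arF f
    | StarF.flat g _ _ => L.arG g
  arG
    | StarG.base g => L.arG g
    | StarG.norm g _ => L.arG g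
    | StarG.sharp f _ _ => L.arF f
    | StarG.flat g _ _ => L.arG g
  otF
    | StarF.base f => L.otF f
    | StarF.norm f _ => L.otF f
    | StarF.sharp f i _ => fun j => if j = i then Pol.neg else L.otF f j
    | StarF.flat g i _ => fun j => if j = i then Pol.pos else (L.otG g j).dual
  otG
    | StarG.base g => L.otG g
    | StarG.norm g _ => L.otG g
    | StarG.sharp f i _ => fun j => if j = i then Pol.pos else (L.otF f j).dual
    | StarG.flat g i _ => fun j => if j = i then Pol.neg else L.otG g j
  regF
    | StarF.base f => L.regF f
    | _ => False
  regG
    | StarG.base g => L.regG g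
    | _ => False
  unaryF
    | StarF.base f, h => L.unaryF f h
    | StarF.norm _ _, h => h.elim
    | StarF.sharp _ _ _, h => h.elim
    | StarF.flat _ _ _, h => h.elim
  unaryG
    | StarG.base g, h => L.unaryG g h
    | StarG.norm _ _, h => h.elim
    | StarG.sharp _ _ _, h => h.elim
    | StarG.flat _ _ _, h => h.elim

section TenseOps

variable {L : Sig.{u}} {C : Type w} [CompleteLattice C]

open Classical in
/-- The normalization of the operation `f` (used for unary `f` only). -/
noncomputable def Ops.normF (O : Ops L C) (f : L.F) (a : Fin (L.arF f) → C) : C :=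
  if ∀ i, a i = (L.otF f i).bot then ⊥ else O.opF f a

open Classical in
/-- The normalization of the operation `g` (used for unary `g` only). -/
noncomputable def Ops.normG (O : Ops L C) (g : L.G) (a : Fin (L.arG g) → C) : C :=
  if ∀ i, a i = (L.otG g i).top then ⊤ else O.opG g a

open Classical in
/-- The interpretation of the connective of `F'` with index `f`. -/
noncomputable def Ops.primeF (O : Ops L C) (f : L.F) (a : Fin (L.arF f) → C) : C :=
  if L.regF f then O.normF f a else O.opF f a

open Classical in
/-- The interpretation of the connective of `G'` with index `g`. -/
noncomputable def Ops.primeG (O : Ops L C) (g : L.G) (a : Fin (L.arG g) → C) : C :=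
  if L.regG g then O.normG g a else O.opG g a

/-- The interpretation of the tense connectives on a complete lattice: normalizations, and the
coordinatewise residuals and Galois-adjoints of the connectives of `F'` and `G'`. -/
noncomputable def Ops.star (O : Ops L C) : Ops L.star C where
  opF
    | StarF.base f => fun a => O.opF f a
    | StarF.norm f _ => fun a => O.normF f a
    | StarF.sharp f i _ => fun (a : Fin (L.arF f) → C) =>
        sInf {c | O.primeF f (Function.update a i c) ≤ a i}
    | StarF.flat g i _ => fun (a : Fin (L.arG g) → C) =>
        sInf {c | a i ≤ O.primeG g (Function.update a i c)}
  opG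
    | StarG.base g => fun a => O.opG g a
    | StarG.norm g _ => fun a => O.normG g a
    | StarG.sharp f i _ => fun (a : Fin (L.arF f) → C) =>
        sSup {c | O.primeF f (Function.update a i c) ≤ a i}
    | StarG.flat g i _ => fun (a : Fin (L.arG g) → C) =>
        sSup {c | a i ≤ O.primeG g (Function.update a i c)}

end TenseOps

/-! ## Formulas -/

/-- Formulas over the signature `L` with variables in `V`. -/
inductive Fm (L : Sig.{u}) (V : Type) : Type u where
  | var (x : V)
  | bot
  | top
  | and (s t : Fm L V)
  | or (s t : Fm L V)
  | opF (f : L.F) (args : Fin (L.arF f) → Fm L V)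
  | opG (g : L.G) (args : Fin (L.arG g) → Fm L V)

/-- The variables of the expanded language. -/
inductive PVar where
  | prop (n : ℕ)
  | nom (n : ℕ)
  | conom (n : ℕ)
  deriving DecidableEq

/-- The formulas of the language; the proposition letters are indexed by `ℕ`. -/
abbrev BaseFm (L : Sig.{u}) : Type u := Fm L ℕ

/-- The formulas of the expanded language manipulated by ALBA. -/
abbrev PlusFm (L : Sig.{u}) : Type u := Fm L.star PVar

namespace Fm

variable {L : Sig.{u}} {V : Type}

/-- The value of a formula under an assignment. -/
def eval {X : Type w} [Lattice X] [BoundedOrder X] (O : Ops L X) (val : V → X) : Fm L V → X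
  | var x => val x
  | bot => ⊥
  | top => ⊤
  | and s t => s.eval O val ⊓ t.eval O val
  | or s t => s.eval O val ⊔ t.eval O val
  | opF f args => O.opF f fun i => (args i).eval O val
  | opG g args => O.opG g fun i => (args i).eval O val

/-- Formulas of the language, regarded as formulas of the expanded language. -/
def toPlus : BaseFm L → PlusFm L
  | var p => var (PVar.prop p)
  | bot => bot
  | top => top
  | and s t => and s.toPlus t.toPlus
  | or s t => or s.toPlus t.toPlus
  | opF f args => opF (L := L.star) (StarF.base f) fun i => (args i).toPlus
  | opG g args => opG (L := L.star) (StarG.base g) fun i => (args i).toPlus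

/-- The variable `x` occurs in the formula. -/
def Occurs (x : V) : Fm L V → Prop
  | var y => y = x
  | bot => False
  | top => False
  | and s t => s.Occurs x ∨ t.Occurs x
  | or s t => s.Occurs x ∨ t.Occurs x
  | opF _ args => ∃ i, (args i).Occurs x
  | opG _ args => ∃ i, (args i).Occurs x

/-- `t.HasLeaf s s' x`: in the generation tree of `t` whose root is signed `s`, some leaf `x` is
signed `s'`. -/
def HasLeaf (s' : Pol) (x : V) : Pol → Fm L V → Prop
  | s, var y => y = x ∧ s = s'
  | _, bot => False
  | _, top => False
  | s, and t₁ t₂ => HasLeaf s' x s t₁ ∨ HasLeaf s' x s t₂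
  | s, or t₁ t₂ => HasLeaf s' x s t₁ ∨ HasLeaf s' x s t₂
  | s, opF f args => ∃ i, HasLeaf s' x (s.child (L.otF f i)) (args i)
  | s, opG g args => ∃ i, HasLeaf s' x (s.child (L.otG g i)) (args i)

/-- `t` is positive in `x`: no occurrence of `x` in `+t` is negative. -/
def Positive (x : V) (t : Fm L V) : Prop := ¬ HasLeaf Pol.neg x Pol.pos t

/-- `t` is negative in `x`: no occurrence of `x` in `+t` is positive. -/
def Negative (x : V) (t : Fm L V) : Prop := ¬ HasLeaf Pol.pos x Pol.pos t

/-- `t.subst x r` is `t(r/x)`. -/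
def subst [DecidableEq V] (x : V) (r : Fm L V) : Fm L V → Fm L V
  | var y => if y = x then r else var y
  | bot => bot
  | top => top
  | and s t => and (subst x r s) (subst x r t)
  | or s t => or (subst x r s) (subst x r t)
  | opF f args => opF f fun i => subst x r (args i)
  | opG g args => opG g fun i => subst x r (args i)

/-- The finite disjunction of a list of formulas. -/
def bigOr : List (Fm L V) → Fm L V
  | [] => bot
  | [t] => t
  | t :: t' :: l => or t (bigOr (t' :: l))

/-- The finite conjunction of a list of formulas. -/
def bigAnd : List (Fm L V) → Fm L V
  | [] => top
  | [t] => t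
  | t :: t' :: l => and t (bigAnd (t' :: l))

end Fm

/-- Formulas `φ(!x)` in which a placeholder `x` occurs exactly once. In `opF f i args c` the
placeholder lies in the `i`th argument, which is `c` (so that `args i` is irrelevant). -/
inductive Ctx (L : Sig.{u}) (V : Type) : Type u where
  | hole
  | andL (c : Ctx L V) (t : Fm L V)
  | andR (t : Fm L V) (c : Ctx L V)
  | orL (c : Ctx L V) (t : Fm L V)
  | orR (t : Fm L V) (c : Ctx L V)
  | opF (f : L.F) (i : Fin (L.arF f)) (args : Fin (L.arF f) → Fm L V) (c : Ctx L V)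
  | opG (g : L.G) (i : Fin (L.arG g)) (args : Fin (L.arG g) → Fm L V) (c : Ctx L V)

namespace Ctx

variable {L : Sig.{u}} {V : Type}

/-- `c.fill r` is `φ(r/!x)`. -/
def fill (r : Fm L V) : Ctx L V → Fm L V
  | hole => r
  | andL c t => Fm.and (c.fill r) t
  | andR t c => Fm.and t (c.fill r)
  | orL c t => Fm.or (c.fill r) t
  | orR t c => Fm.or t (c.fill r)
  | opF f i args c => Fm.opF f (Function.update args i (c.fill r))
  | opG g i args c => Fm.opG g (Function.update args i (c.fill r))

/-- The sign of the placeholder in the generation tree whose root is signed `s`. -/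
def holeSign : Pol → Ctx L V → Pol
  | s, hole => s
  | s, andL c _ => c.holeSign s
  | s, andR _ c => c.holeSign s
  | s, orL c _ => c.holeSign s
  | s, orR _ c => c.holeSign s
  | s, opF f i _ c => c.holeSign (s.child (L.otF f i))
  | s, opG g i _ c => c.holeSign (s.child (L.otG g i))

/-- In the generation tree whose root is signed `s`, the branch from the placeholder to the root
is SAC: every node on it, apart from the placeholder, is a `+f` or a `-g`. -/
def IsSAC : Pol → Ctx L V → Prop
  | _, hole => True
  | _, andL _ _ => False
  | _, andR _ _ => False
  | _, orL _ _ => False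
  | _, orR _ _ => False
  | s, opF f i _ c => s = Pol.pos ∧ c.IsSAC (s.child (L.otF f i))
  | s, opG g i _ c => s = Pol.neg ∧ c.IsSAC (s.child (L.otG g i))

end Ctx

/-! ## Inequalities, systems and validity -/

/-- Inequalities `lhs ≤ rhs`. -/
@[ext]
structure Ineq (L : Sig.{u}) (V : Type) where
  lhs : Fm L V
  rhs : Fm L V

/-- The variable `x` occurs in the inequality. -/
def Ineq.Occurs {L : Sig.{u}} {V : Type} (x : V) (q : Ineq L V) : Prop :=
  q.lhs.Occurs x ∨ q.rhs.Occurs x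

/-- Inequalities of the language, regarded as inequalities of the expanded language. -/
def Ineq.toPlus {L : Sig.{u}} (q : Ineq L ℕ) : Ineq L.star PVar := ⟨q.lhs.toPlus, q.rhs.toPlus⟩

/-- Substitution in both sides of an inequality. -/
def Ineq.subst {L : Sig.{u}} {V : Type} [DecidableEq V] (x : V) (r : Fm L V) (q : Ineq L V) :
    Ineq L V := ⟨Fm.subst x r q.lhs, Fm.subst x r q.rhs⟩

/-- A system `(S, Ineq)`, representing the quasi-inequality `& S ⇒ Ineq`. -/
@[ext]
structure Sys (L : Sig.{u}) where
  S : Set (Ineq L.star PVar)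
  ineq : Ineq L.star PVar

/-- The variable `x` occurs in the system. -/
def Sys.Occurs {L : Sig.{u}} (x : PVar) (Y : Sys L) : Prop :=
  (∃ q ∈ Y.S, q.Occurs x) ∨ Y.ineq.Occurs x

/-- A system is pure if no proposition letter occurs in it. -/
def Sys.Pure {L : Sig.{u}} (Y : Sys L) : Prop := ∀ p, ¬ Y.Occurs (PVar.prop p)

section Validity

variable {L : Sig.{u}} {A : Type v} {C : Type w} [Lattice A] [BoundedOrder A] [CompleteLattice C]

/-- The inequality is true under the given assignment. -/
def Ineq.Holds {V : Type} (O : Ops L C) (val : V → C) (q : Ineq L V) : Prop :=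
  q.lhs.eval O val ≤ q.rhs.eval O val

/-- The canonical extension validates an inequality of the language. -/
def ValidIneq (𝔸 : LatticeExpansion L A) (e : BoundedLatticeHom A C) (q : Ineq L ℕ) : Prop :=
  ∀ val : ℕ → C, q.Holds (canOps 𝔸 e) val

/-- Assignments for the expanded language: proposition letters take arbitrary values, nominals
closed ones and co-nominals open ones. -/
structure IsAssignment (e : BoundedLatticeHom A C) (val : PVar → C) : Prop where
  nom : ∀ n, IsClosedElt e (val (PVar.nom n))
  conom : ∀ n, IsOpenElt e (val (PVar.conom n))

/-- The canonical extension validates the quasi-inequality `& S ⇒ Ineq`. -/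
def ValidSys (𝔸 : LatticeExpansion L A) (e : BoundedLatticeHom A C) (Y : Sys L) : Prop :=
  ∀ val : PVar → C, IsAssignment e val →
    (∀ q ∈ Y.S, q.Holds (canOps 𝔸 e).star val) → Y.ineq.Holds (canOps 𝔸 e).star val

end Validity

/-! ## The algorithm -/

section Algorithm

variable {L : Sig.{u}}

/-- Splitting rules. -/
inductive SplitRule {V : Type} : Ineq L V → Set (Ineq L V) → Prop
  | and (α β γ : Fm L V) : SplitRule ⟨α, Fm.and β γ⟩ {⟨α, β⟩, ⟨α, γ⟩}
  | or (α β γ : Fm L V) : SplitRule ⟨Fm.or α β, γ⟩ {⟨α, γ⟩, ⟨β, γ⟩}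

/-- Distribution of a node `+f` (of a node `-g`) over a child signed `+∨` or `-∧`; the first
argument is the sign of the node. -/
inductive DistRule : Pol → BaseFm L → BaseFm L → Prop
  | fOr (f : L.F) (i : Fin (L.arF f)) (h : L.otF f i = Pol.pos)
      (args : Fin (L.arF f) → BaseFm L) (s t : BaseFm L) :
      DistRule Pol.pos (Fm.opF f (Function.update args i (Fm.or s t)))
        (Fm.or (Fm.opF f (Function.update args i s)) (Fm.opF f (Function.update args i t)))
  | fAnd (f : L.F) (i : Fin (L.arF f)) (h : L.otF f i = Pol.neg)
      (args : Fin (L.arF f) → BaseFm L) (s t : BaseFm L) :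
      DistRule Pol.pos (Fm.opF f (Function.update args i (Fm.and s t)))
        (Fm.or (Fm.opF f (Function.update args i s)) (Fm.opF f (Function.update args i t)))
  | gAnd (g : L.G) (i : Fin (L.arG g)) (h : L.otG g i = Pol.pos)
      (args : Fin (L.arG g) → BaseFm L) (s t : BaseFm L) :
      DistRule Pol.neg (Fm.opG g (Function.update args i (Fm.and s t)))
        (Fm.and (Fm.opG g (Function.update args i s)) (Fm.opG g (Function.update args i t)))
  | gOr (g : L.G) (i : Fin (L.arG g)) (h : L.otG g i = Pol.neg)
      (args : Fin (L.arG g) → BaseFm L) (s t : BaseFm L) :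
      DistRule Pol.neg (Fm.opG g (Function.update args i (Fm.or s t)))
        (Fm.and (Fm.opG g (Function.update args i s)) (Fm.opG g (Function.update args i t)))

/-- The rules of the preprocessing stage. An inequality `α ≤ β` is positive in `p` if `α` is
negative and `β` is positive in `p`, and dually. -/
inductive PreRule : Ineq L ℕ → Set (Ineq L ℕ) → Prop
  | elimPos (p : ℕ) (q : Ineq L ℕ) (hl : q.lhs.Negative p) (hr : q.rhs.Positive p) :
      PreRule q {q.subst p Fm.bot}
  | elimNeg (p : ℕ) (q : Ineq L ℕ) (hl : q.lhs.Positive p) (hr : q.rhs.Negative p) :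
      PreRule q {q.subst p Fm.top}
  | distLeft (c : Ctx L ℕ) (t t' ψ : BaseFm L) (h : DistRule (c.holeSign Pol.pos) t t') :
      PreRule ⟨c.fill t, ψ⟩ {⟨c.fill t', ψ⟩}
  | distRight (c : Ctx L ℕ) (t t' φ : BaseFm L) (h : DistRule (c.holeSign Pol.neg) t t') :
      PreRule ⟨φ, c.fill t⟩ {⟨φ, c.fill t'⟩}
  | split (q : Ineq L ℕ) (D : Set (Ineq L ℕ)) (h : SplitRule q D) : PreRule q D

/-- One step of preprocessing: an inequality is replaced according to a rule. -/
inductive PreStep : Set (Ineq L ℕ) → Set (Ineq L ℕ) → Prop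
  | mk (Γ : Set (Ineq L ℕ)) (q : Ineq L ℕ) (D : Set (Ineq L ℕ)) (hq : q ∈ Γ) (h : PreRule q D) :
      PreStep Γ (Γ \ {q} ∪ D)

/-- Residuation rules, for normal and for regular connectives (the latter are unary, so that
`fun _ => φ` is their only argument). -/
inductive ResRule : Ineq L.star PVar → Set (Ineq L.star PVar) → Prop
  | fPos (f : L.F) (hf : ¬ L.regF f) (i : Fin (L.arF f)) (h : L.otF f i = Pol.pos)
      (args : Fin (L.arF f) → PlusFm L) (ψ : PlusFm L) :
      ResRule ⟨Fm.opF (L := L.star) (StarF.base f) args, ψ⟩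
        {⟨args i, Fm.opG (L := L.star) (StarG.sharp f i h) (Function.update args i ψ)⟩}
  | fNeg (f : L.F) (hf : ¬ L.regF f) (i : Fin (L.arF f)) (h : L.otF f i = Pol.neg)
      (args : Fin (L.arF f) → PlusFm L) (ψ : PlusFm L) :
      ResRule ⟨Fm.opF (L := L.star) (StarF.base f) args, ψ⟩
        {⟨Fm.opF (L := L.star) (StarF.sharp f i h) (Function.update args i ψ), args i⟩}
  | gPos (g : L.G) (hg : ¬ L.regG g) (i : Fin (L.arG g)) (h : L.otG g i = Pol.pos)
      (args : Fin (L.arG g) → PlusFm L) (ψ : PlusFm L) :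
      ResRule ⟨ψ, Fm.opG (L := L.star) (StarG.base g) args⟩
        {⟨Fm.opF (L := L.star) (StarF.flat g i h) (Function.update args i ψ), args i⟩}
  | gNeg (g : L.G) (hg : ¬ L.regG g) (i : Fin (L.arG g)) (h : L.otG g i = Pol.neg)
      (args : Fin (L.arG g) → PlusFm L) (ψ : PlusFm L) :
      ResRule ⟨ψ, Fm.opG (L := L.star) (StarG.base g) args⟩
        {⟨args i, Fm.opG (L := L.star) (StarG.flat g i h) (Function.update args i ψ)⟩}
  | fRegPos (f : L.F) (hf : L.regF f) (i : Fin (L.arF f)) (h : L.otF f i = Pol.pos)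
      (φ ψ : PlusFm L) :
      ResRule ⟨Fm.opF (L := L.star) (StarF.base f) (fun _ => φ), ψ⟩
        {⟨Fm.opF (L := L.star) (StarF.base f) (fun _ => Fm.bot), ψ⟩,
          ⟨φ, Fm.opG (L := L.star) (StarG.sharp f i h) (fun _ => ψ)⟩}
  | fRegNeg (f : L.F) (hf : L.regF f) (i : Fin (L.arF f)) (h : L.otF f i = Pol.neg)
      (φ ψ : PlusFm L) :
      ResRule ⟨Fm.opF (L := L.star) (StarF.base f) (fun _ => φ), ψ⟩
        {⟨Fm.opF (L := L.star) (StarF.base f) (fun _ => Fm.top), ψ⟩,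
          ⟨Fm.opF (L := L.star) (StarF.sharp f i h) (fun _ => ψ), φ⟩}
  | gRegPos (g : L.G) (hg : L.regG g) (i : Fin (L.arG g)) (h : L.otG g i = Pol.pos)
      (φ ψ : PlusFm L) :
      ResRule ⟨φ, Fm.opG (L := L.star) (StarG.base g) (fun _ => ψ)⟩
        {⟨φ, Fm.opG (L := L.star) (StarG.base g) (fun _ => Fm.top)⟩,
          ⟨Fm.opF (L := L.star) (StarF.flat g i h) (fun _ => φ), ψ⟩}
  | gRegNeg (g : L.G) (hg : L.regG g) (i : Fin (L.arG g)) (h : L.otG g i = Pol.neg)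
      (φ ψ : PlusFm L) :
      ResRule ⟨φ, Fm.opG (L := L.star) (StarG.base g) (fun _ => ψ)⟩
        {⟨φ, Fm.opG (L := L.star) (StarG.base g) (fun _ => Fm.bot)⟩,
          ⟨ψ, Fm.opG (L := L.star) (StarG.flat g i h) (fun _ => φ)⟩}

/-- `j` is the first nominal not occurring in the system. -/
def Sys.FreshNom (Y : Sys L) (j : ℕ) : Prop := IsLeast {k | ¬ Y.Occurs (PVar.nom k)} j

/-- `m` is the first co-nominal not occurring in the system. -/
def Sys.FreshConom (Y : Sys L) (m : ℕ) : Prop := IsLeast {k | ¬ Y.Occurs (PVar.conom k)} m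

/-- One application of a reduction rule to a system. -/
inductive RedStep : Sys L → Sys L → Prop
  | approxLeftPos (S : Set (Ineq L.star PVar)) (c : Ctx L.star PVar) (γ : BaseFm L)
      (ψ : PlusFm L) (j : ℕ) (hs : c.holeSign Pol.pos = Pol.pos) (hc : c.IsSAC Pol.pos)
      (hj : Sys.FreshNom ⟨S, ⟨c.fill γ.toPlus, ψ⟩⟩ j) :
      RedStep ⟨S, ⟨c.fill γ.toPlus, ψ⟩⟩
        ⟨S ∪ {⟨Fm.var (PVar.nom j), γ.toPlus⟩}, ⟨c.fill (Fm.var (PVar.nom j)), ψ⟩⟩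
  | approxLeftNeg (S : Set (Ineq L.star PVar)) (c : Ctx L.star PVar) (γ : BaseFm L)
      (ψ : PlusFm L) (m : ℕ) (hs : c.holeSign Pol.pos = Pol.neg) (hc : c.IsSAC Pol.pos)
      (hm : Sys.FreshConom ⟨S, ⟨c.fill γ.toPlus, ψ⟩⟩ m) :
      RedStep ⟨S, ⟨c.fill γ.toPlus, ψ⟩⟩
        ⟨S ∪ {⟨γ.toPlus, Fm.var (PVar.conom m)⟩}, ⟨c.fill (Fm.var (PVar.conom m)), ψ⟩⟩
  | approxRightPos (S : Set (Ineq L.star PVar)) (c : Ctx L.star PVar) (γ : BaseFm L)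
      (φ : PlusFm L) (j : ℕ) (hs : c.holeSign Pol.neg = Pol.pos) (hc : c.IsSAC Pol.neg)
      (hj : Sys.FreshNom ⟨S, ⟨φ, c.fill γ.toPlus⟩⟩ j) :
      RedStep ⟨S, ⟨φ, c.fill γ.toPlus⟩⟩
        ⟨S ∪ {⟨Fm.var (PVar.nom j), γ.toPlus⟩}, ⟨φ, c.fill (Fm.var (PVar.nom j))⟩⟩
  | approxRightNeg (S : Set (Ineq L.star PVar)) (c : Ctx L.star PVar) (γ : BaseFm L)
      (φ : PlusFm L) (m : ℕ) (hs : c.holeSign Pol.neg = Pol.neg) (hc : c.IsSAC Pol.neg)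
      (hm : Sys.FreshConom ⟨S, ⟨φ, c.fill γ.toPlus⟩⟩ m) :
      RedStep ⟨S, ⟨φ, c.fill γ.toPlus⟩⟩
        ⟨S ∪ {⟨γ.toPlus, Fm.var (PVar.conom m)⟩}, ⟨φ, c.fill (Fm.var (PVar.conom m))⟩⟩
  | residuation (S : Set (Ineq L.star PVar)) (q r : Ineq L.star PVar)
      (D : Set (Ineq L.star PVar)) (hr : r ∈ S) (h : ResRule r D) :
      RedStep ⟨S, q⟩ ⟨S \ {r} ∪ D, q⟩
  | splitting (S : Set (Ineq L.star PVar)) (q r : Ineq L.star PVar)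
      (D : Set (Ineq L.star PVar)) (hr : r ∈ S) (h : SplitRule r D) :
      RedStep ⟨S, q⟩ ⟨S \ {r} ∪ D, q⟩
  | ackermannRight (p : ℕ) (αs : List (PlusFm L)) (βγs : List (Ineq L.star PVar))
      (q : Ineq L.star PVar)
      (hα : ∀ α ∈ αs, ¬ α.Occurs (PVar.prop p)) (hq : ¬ q.Occurs (PVar.prop p))
      (hβ : ∀ r ∈ βγs, r.lhs.Positive (PVar.prop p))
      (hγ : ∀ r ∈ βγs, r.rhs.Negative (PVar.prop p)) :
      RedStep
        ⟨{r | ∃ α ∈ αs, r = ⟨α, Fm.var (PVar.prop p)⟩} ∪ {r | r ∈ βγs}, q⟩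
        ⟨{r | ∃ r' ∈ βγs, r = r'.subst (PVar.prop p) (Fm.bigOr αs)}, q⟩
  | ackermannLeft (p : ℕ) (αs : List (PlusFm L)) (βγs : List (Ineq L.star PVar))
      (q : Ineq L.star PVar)
      (hα : ∀ α ∈ αs, ¬ α.Occurs (PVar.prop p)) (hq : ¬ q.Occurs (PVar.prop p))
      (hβ : ∀ r ∈ βγs, r.lhs.Negative (PVar.prop p))
      (hγ : ∀ r ∈ βγs, r.rhs.Positive (PVar.prop p)) :
      RedStep
        ⟨{r | ∃ α ∈ αs, r = ⟨Fm.var (PVar.prop p), α⟩} ∪ {r | r ∈ βγs}, q⟩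
        ⟨{r | ∃ r' ∈ βγs, r = r'.subst (PVar.prop p) (Fm.bigAnd αs)}, q⟩

/-- ALBA succeeds on the inequality `q` and yields the conjunction of the quasi-inequalities
in `Q`: some run of the preprocessing turns `q` into the set `Γ` of inequalities, and for each
`r ∈ Γ` the initial system `(∅, r)` is transformed by reduction rules into the pure system
`out r`, the systems so obtained being those in `Q`. -/
def Yields (q : Ineq L ℕ) (Q : Set (Sys L)) : Prop :=
  ∃ Γ : Set (Ineq L ℕ), Relation.ReflTransGen PreStep {q} Γ ∧
    ∃ out : Ineq L ℕ → Sys L,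
      (∀ r ∈ Γ, Relation.ReflTransGen RedStep ⟨∅, r.toPlus⟩ (out r) ∧ (out r).Pure) ∧
      Q = out '' Γ

end Algorithm

end ALBA

/-! Every rule of ALBA preserves validity on the canonical extension in both directions, so
correctness follows by induction along the run. Distribution, splitting and residuation are
equivalences under each fixed assignment; elimination, approximation and the Ackermann rules change
the value of one variable.

The algebraic core is `sigmaExt_coordJoin`: if an operation preserves binary joins in each
coordinate, its σ-extension preserves all nonempty joins in each coordinate. The proof uses
compactness twice and no completely join-irreducible elements; `piExt_coordMeet` is the order dual.
Distribution and residuation (`CoordJoin.le_iff`, `CoordMeet.le_iff`) follow. Regular connectives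
need not preserve the empty join, so each argument has to exhibit a nonempty family. In the regular
residuation rule this is the role of the extra inequality `f(⊥) ≤ ψ`.

For approximation, every element is the join of the closed elements below it, and a SAC branch
preserves nonempty joins in the signed orders (`Ctx.eval_sup_le`). Hence `φ'(γ)` is determined by
the values `φ'(k)` with `k` closed below `γ`, and a fresh nominal ranges over exactly these `k`.
Join preservation is needed only for the original connectives: the inequality of a system never
acquires a residual or a normalization (`RedStep.isBase`).

For the Ackermann rules, proposition letters range over all elements, so no topological condition
arises. Monotonicity of all operations (`Ops.Mono.star`) suffices, with the join (meet) of the `α`s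
as the extremal value of `p`. -/

namespace ALBA

open Function

/-! ### Orders, joins and meets twisted by an order-type -/

namespace Pol

@[simp] lemma child_pos (ε : Pol) : pos.child ε = ε := by cases ε <;> rfl

@[simp] lemma child_neg (ε : Pol) : neg.child ε = ε.dual := by cases ε <;> rfl

section Order

variable {X : Type*}

lemma le_dual_iff [LE X] (ε : Pol) {x y : X} : ε.dual.le x y ↔ ε.le y x := by cases ε <;> rfl

lemma le_refl [Preorder X] (ε : Pol) (x : X) : ε.le x x := by cases ε <;> exact _root_.le_refl x

lemma le_trans [Preorder X] {ε : Pol} {x y z : X} (h : ε.le x y) (h' : ε.le y z) : ε.le x z := by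
  cases ε
  exacts [_root_.le_trans h h', _root_.le_trans h' h]

lemma bot_le [LE X] [BoundedOrder X] (ε : Pol) (x : X) : ε.le ε.bot x := by
  cases ε
  exacts [_root_.bot_le, _root_.le_top]

lemma le_top [LE X] [BoundedOrder X] (ε : Pol) (x : X) : ε.le x ε.top := by
  cases ε
  exacts [_root_.le_top, _root_.bot_le]

lemma eq_bot_of_le [PartialOrder X] [BoundedOrder X] {ε : Pol} {x : X} (h : ε.le x ε.bot) :
    x = ε.bot := by
  cases ε
  exacts [le_bot_iff.1 h, top_le_iff.1 h]

lemma eq_top_of_le [PartialOrder X] [BoundedOrder X] {ε : Pol} {x : X} (h : ε.le ε.top x) :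
    x = ε.top := by
  cases ε
  exacts [top_le_iff.1 h, le_bot_iff.1 h]

variable [Lattice X]

lemma le_join_left (ε : Pol) (x y : X) : ε.le x (ε.join x y) := by
  cases ε
  exacts [le_sup_left, inf_le_left]

lemma le_join_right (ε : Pol) (x y : X) : ε.le y (ε.join x y) := by
  cases ε
  exacts [le_sup_right, inf_le_right]

lemma join_eq_right {ε : Pol} {x y : X} (h : ε.le x y) : ε.join x y = y := by
  cases ε
  exacts [sup_eq_right.2 h, inf_eq_right.2 h]

lemma meet_le_left (ε : Pol) (x y : X) : ε.le (ε.meet x y) x := by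
  cases ε
  exacts [inf_le_left, le_sup_left]

lemma meet_le_right (ε : Pol) (x y : X) : ε.le (ε.meet x y) y := by
  cases ε
  exacts [inf_le_right, le_sup_right]

lemma le_meet {ε : Pol} {x y z : X} (h : ε.le x y) (h' : ε.le x z) : ε.le x (ε.meet y z) := by
  cases ε
  exacts [le_inf h h', sup_le h h']

end Order

section CompleteLattice

variable {C : Type*} [CompleteLattice C]

/-- The join of a subset of `C^ε`. -/
def sup : Pol → Set C → C
  | pos, X => sSup X
  | neg, X => sInf X

/-- The meet of a subset of `C^ε`. -/
def inf : Pol → Set C → C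
  | pos, X => sInf X
  | neg, X => sSup X

lemma sup_dual (ε : Pol) (X : Set C) : ε.dual.sup X = ε.inf X := by cases ε <;> rfl

lemma le_sup {ε : Pol} {X : Set C} {x : C} (h : x ∈ X) : ε.le x (ε.sup X) := by
  cases ε
  exacts [le_sSup h, sInf_le h]

lemma sup_le {ε : Pol} {X : Set C} {y : C} (h : ∀ x ∈ X, ε.le x y) : ε.le (ε.sup X) y := by
  cases ε
  exacts [sSup_le h, le_sInf h]

lemma inf_le {ε : Pol} {X : Set C} {x : C} (h : x ∈ X) : ε.le (ε.inf X) x := by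
  cases ε
  exacts [sInf_le h, le_sSup h]

lemma le_inf {ε : Pol} {X : Set C} {y : C} (h : ∀ x ∈ X, ε.le y x) : ε.le y (ε.inf X) := by
  cases ε
  exacts [le_sInf h, sSup_le h]

lemma sup_pair (ε : Pol) (x y : C) : ε.sup {x, y} = ε.join x y := by
  cases ε
  exacts [sSup_pair, sInf_pair]

lemma inf_pair (ε : Pol) (x y : C) : ε.inf {x, y} = ε.meet x y := by
  cases ε
  exacts [sInf_pair, sSup_pair]

lemma le_sup_child_pos {ε : Pol} {x : C} {X : Set C} :
    (pos.child ε).le x ((pos.child ε).sup X) ↔ ε.le x (ε.sup X) := by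
  rw [child_pos]

/-- Below a node `-g` the signed order of the `i`th child is opposite to the order-type, so its
signed joins are meets of `C^ε`, the kind that `CoordMeet` handles. Together with `le_sup_child_pos`
this turns the induction hypothesis at a child into a statement about a coordinate. -/
lemma le_sup_child_neg {ε : Pol} {x : C} {X : Set C} :
    (neg.child ε).le x ((neg.child ε).sup X) ↔ ε.le (ε.inf X) x := by
  rw [child_neg, le_dual_iff, sup_dual]

end CompleteLattice

end Pol

/-! ### Coordinatewise preservation, monotonicity and residuation -/

section Operations

variable {n : ℕ} {C : Type*}

/-- `f` is monotone as a map from `C^ε` to `C`. -/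
def OrdMono [LE C] (ε : Fin n → Pol) (f : (Fin n → C) → C) : Prop :=
  ∀ a b, (∀ i, (ε i).le (a i) (b i)) → f a ≤ f b

/-- `f : C^ε → C` preserves nonempty joins in each coordinate (the nontrivial inequality). -/
def CoordJoin [CompleteLattice C] (ε : Fin n → Pol) (f : (Fin n → C) → C) : Prop :=
  ∀ (a : Fin n → C) (i : Fin n) (X : Set C) (b : C), X.Nonempty →
    (∀ x ∈ X, f (update a i x) ≤ b) → f (update a i ((ε i).sup X)) ≤ b

/-- `g : C^ε → C` preserves nonempty meets in each coordinate (the nontrivial inequality). -/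
def CoordMeet [CompleteLattice C] (ε : Fin n → Pol) (g : (Fin n → C) → C) : Prop :=
  ∀ (a : Fin n → C) (i : Fin n) (X : Set C) (b : C), X.Nonempty →
    (∀ x ∈ X, b ≤ g (update a i x)) → b ≤ g (update a i ((ε i).inf X))

lemma update_le_update [Preorder C] {ε : Fin n → Pol} {a b : Fin n → C} {i : Fin n} {x y : C}
    (h : ∀ j, j ≠ i → (ε j).le (a j) (b j)) (hxy : (ε i).le x y) (j : Fin n) :
    (ε j).le (update a i x j) (update b i y j) := by
  rcases eq_or_ne j i with rfl | hj
  · simpa using hxy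
  · simpa [hj] using h j hj

lemma OrdMono.update [Preorder C] {ε : Fin n → Pol} {f : (Fin n → C) → C} (hf : OrdMono ε f)
    (a : Fin n → C) {i : Fin n} {x y : C} (h : (ε i).le x y) :
    f (update a i x) ≤ f (update a i y) :=
  hf _ _ (update_le_update (fun j _ => (ε j).le_refl _) h)

/-- The coordinates are raised from `a` to `b` one at a time; at each step `b j` is the join of `a
j` and `b j`, so the old value is a joinand of the new one. -/
lemma ordMono_of_join [Lattice C] {ε : Fin n → Pol} {f : (Fin n → C) → C}
    (hf : ∀ a i x y, f (Function.update a i ((ε i).join x y))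
      = f (Function.update a i x) ⊔ f (Function.update a i y)) : OrdMono ε f := by
  intro a b hab
  have key : ∀ s : Finset (Fin n), f a ≤ f (s.piecewise b a) := by
    intro s
    induction s using Finset.induction_on with
    | empty => simp
    | insert j s hj ih =>
      refine ih.trans ?_
      rw [Finset.piecewise_insert, ← Pol.join_eq_right (hab j), hf]
      refine le_trans (le_of_eq ?_) le_sup_left
      rw [← Finset.piecewise_eq_of_notMem s b a hj, update_eq_self]
  simpa using key Finset.univ

section Complete

variable [CompleteLattice C] {ε : Fin n → Pol} {f : (Fin n → C) → C}

lemma CoordJoin.map_join (hf : CoordJoin ε f) (hm : OrdMono ε f) (a : Fin n → C) (i : Fin n)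
    (x y : C) : f (update a i ((ε i).join x y)) = f (update a i x) ⊔ f (update a i y) := by
  refine le_antisymm ?_ (sup_le (hm.update a ((ε i).le_join_left x y))
    (hm.update a ((ε i).le_join_right x y)))
  rw [← Pol.sup_pair]
  refine hf a i _ _ ⟨x, by simp⟩ ?_
  rintro z (rfl | rfl)
  exacts [le_sup_left, le_sup_right]

lemma CoordMeet.map_meet (hf : CoordMeet ε f) (hm : OrdMono ε f) (a : Fin n → C) (i : Fin n)
    (x y : C) : f (update a i ((ε i).meet x y)) = f (update a i x) ⊓ f (update a i y) := by
  refine le_antisymm (le_inf (hm.update a ((ε i).meet_le_left x y))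
    (hm.update a ((ε i).meet_le_right x y))) ?_
  rw [← Pol.inf_pair]
  refine hf a i _ _ ⟨x, by simp⟩ ?_
  rintro z (rfl | rfl)
  exacts [inf_le_left, inf_le_right]

/-- Coordinatewise residuation. -/
lemma CoordJoin.le_iff (hf : CoordJoin ε f) (hm : OrdMono ε f) {a : Fin n → C} {i : Fin n} {b : C}
    (hbot : f (update a i (ε i).bot) ≤ b) :
    f a ≤ b ↔ (ε i).le (a i) ((ε i).sup {c | f (update a i c) ≤ b}) := by
  constructor
  · intro h
    exact Pol.le_sup (by simpa using h)
  · intro h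
    -- `hbot` puts the bottom of `C^ε` into this set, so preservation of nonempty joins is enough.
    have := hf a i {c | f (update a i c) ≤ b} b ⟨_, hbot⟩ fun x hx => hx
    exact le_trans (by simpa using hm.update a h) this

lemma CoordMeet.le_iff (hf : CoordMeet ε f) (hm : OrdMono ε f) {a : Fin n → C} {i : Fin n} {b : C}
    (htop : b ≤ f (update a i (ε i).top)) :
    b ≤ f a ↔ (ε i).le ((ε i).inf {c | b ≤ f (update a i c)}) (a i) := by
  constructor
  · intro h
    exact Pol.inf_le (by simpa using h)
  · intro h
    have := hf a i {c | b ≤ f (update a i c)} b ⟨_, htop⟩ fun x hx => hx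
    exact le_trans this (by simpa using hm.update a h)

end Complete

end Operations

/-- Merges the finite subsets delivered by compactness into a single element. For `ε = neg` the
bound is a lower bound; nonemptiness of `I` covers the case `T = ∅`. -/
lemma exists_upperBound_of_finite {X : Type*} [Lattice X] {ε : Pol} {I T : Set X} (hne : I.Nonempty)
    (hI : ∀ x ∈ I, ∀ y ∈ I, ε.join x y ∈ I) (hT : T.Finite) (hTI : T ⊆ I) :
    ∃ a ∈ I, ∀ t ∈ T, ε.le t a := by
  induction T, hT using Set.Finite.induction_on with
  | empty => exact ⟨hne.some, hne.some_mem, by simp⟩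
  | @insert t T _ _ ih =>
    obtain ⟨a, ha, hTa⟩ := ih fun x hx => hTI (Set.mem_insert_of_mem _ hx)
    refine ⟨ε.join t a, hI _ (hTI (Set.mem_insert _ _)) _ ha, ?_⟩
    rintro s (rfl | hs)
    exacts [ε.le_join_left _ _, Pol.le_trans (hTa s hs) (ε.le_join_right _ _)]

/-! ### Compactness and density arguments for the σ- and π-extensions -/

section Canonical

variable {A : Type v} {C : Type w} [Lattice A] [BoundedOrder A] [CompleteLattice C]
  {e : BoundedLatticeHom A C}

lemma isClosedElt_map (e : BoundedLatticeHom A C) (a : A) : IsClosedElt e (e a) := ⟨{a}, by simp⟩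

lemma isOpenElt_map (e : BoundedLatticeHom A C) (a : A) : IsOpenElt e (e a) := ⟨{a}, by simp⟩

/-- Ensures that the closed elements below a given element form a nonempty family, which regular
connectives require. -/
lemma Pol.isClosed_bot (e : BoundedLatticeHom A C) (ε : Pol) : ε.IsClosed e ε.bot := by
  cases ε
  · simpa [Pol.bot, Pol.IsClosed] using isClosedElt_map e ⊥
  · simpa [Pol.bot, Pol.IsClosed] using isOpenElt_map e ⊤

lemma IsCanonicalExtension.sup_closed (he : IsCanonicalExtension e) (ε : Pol) (u : C) :
    ε.sup {k | ε.IsClosed e k ∧ ε.le k u} = u := by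
  cases ε
  · obtain ⟨S, hS, rfl⟩ := he.dense_join u
    exact le_antisymm (sSup_le fun k hk => hk.2) (sSup_le_sSup fun k hk => ⟨hS k hk, le_sSup hk⟩)
  · obtain ⟨S, hS, rfl⟩ := he.dense_meet u
    exact le_antisymm (sInf_le_sInf fun k hk => ⟨hS k hk, sInf_le hk⟩) (le_sInf fun k hk => hk.2)

lemma IsCanonicalExtension.le_of_forall_open (he : IsCanonicalExtension e) {x y : C}
    (h : ∀ o, IsOpenElt e o → y ≤ o → x ≤ o) : x ≤ y := by
  obtain ⟨S, hS, rfl⟩ := he.dense_meet y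
  exact le_sInf fun o ho => h o (hS o ho) (sInf_le ho)

/-- Compactness for a closed element and an ideal of `A^ε`. -/
lemma IsCanonicalExtension.exists_mem_of_le_sup (he : IsCanonicalExtension e) {ε : Pol} {k : C}
    (hk : ε.IsClosed e k) {I : Set A} (hne : I.Nonempty)
    (hI : ∀ x ∈ I, ∀ y ∈ I, ε.join x y ∈ I) (h : ε.le k (ε.sup (e '' I))) :
    ∃ a ∈ I, ε.le k (e a) := by
  cases ε
  · obtain ⟨S, rfl⟩ := hk
    obtain ⟨S', hS', T', hT', -, hfin, hle⟩ := he.compact S I h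
    obtain ⟨a, ha, hTa⟩ := exists_upperBound_of_finite hne hI hfin hT'
    refine ⟨a, ha, (sInf_le_sInf (Set.image_mono hS')).trans (hle.trans (sSup_le ?_))⟩
    rintro _ ⟨t, ht, rfl⟩
    exact OrderHomClass.mono e (hTa t ht)
  · obtain ⟨S, rfl⟩ := hk
    -- Here `k` is open and `I` is closed under meets, so `I` takes the left-hand side of
    -- compactness.
    obtain ⟨T', hT', S', hS', hfin, -, hle⟩ := he.compact I S h
    obtain ⟨a, ha, hTa⟩ := exists_upperBound_of_finite hne hI hfin hT'
    refine ⟨a, ha, le_trans (le_trans (le_sInf ?_) hle) (sSup_le_sSup (Set.image_mono hS'))⟩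
    rintro _ ⟨t, ht, rfl⟩
    exact OrderHomClass.mono e (hTa t ht)

variable {n : ℕ} {ε : Fin n → Pol} {f : (Fin n → A) → A}

lemma sigmaExt_ordMono (e : BoundedLatticeHom A C) (ε : Fin n → Pol) (f : (Fin n → A) → A) :
    OrdMono ε (sigmaExt e ε f) := by
  intro a b hab
  refine sSup_le_sSup ?_
  rintro _ ⟨k, hk, hka, rfl⟩
  exact ⟨k, hk, fun i => Pol.le_trans (hka i) (hab i), rfl⟩

/-- The values of `f` at tuples of `A` above `k` are down-directed by monotonicity, so compactness
selects one of them below `o`. -/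
lemma exists_le_of_sigmaClosed_le (he : IsCanonicalExtension e) (hf : OrdMono ε f)
    {k : Fin n → C} {o : C} (ho : IsOpenElt e o) (h : sigmaClosed e ε f k ≤ o) :
    ∃ a : Fin n → A, (∀ i, (ε i).le (k i) (e (a i))) ∧ e (f a) ≤ o := by
  obtain ⟨T, rfl⟩ := ho
  -- Elements above a value `f a` are admitted so that `S` is closed under meets: the meet of two
  -- values need not be a value, but it lies above `f` of the coordinatewise meet.
  set S : Set A := {x | ∃ a : Fin n → A, (∀ i, (ε i).le (k i) (e (a i))) ∧ f a ≤ x}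
  have hle : sInf (e '' S) ≤ sSup (e '' T) := by
    refine le_trans (sInf_le_sInf ?_) h
    rintro _ ⟨a, ha, rfl⟩
    exact ⟨f a, ⟨a, ha, le_rfl⟩, rfl⟩
  have hne : S.Nonempty := by
    refine ⟨_, fun i => (ε i).top, fun i => ?_, le_rfl⟩
    have : e (ε i).top = (ε i).top := by cases ε i <;> simp [Pol.top]
    rw [this]
    exact (ε i).le_top _
  obtain ⟨S', hS', T', hT', hfin, -, hle'⟩ := he.compact S T hle
  have hmeet : ∀ x ∈ S, ∀ y ∈ S, Pol.neg.join x y ∈ S := by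
    rintro x ⟨a, ha, hax⟩ y ⟨b, hb, hby⟩
    refine ⟨fun i => (ε i).meet (a i) (b i), fun i => ?_, le_inf ?_ ?_⟩
    · have : e ((ε i).meet (a i) (b i)) = (ε i).meet (e (a i)) (e (b i)) := by
        cases ε i <;> simp [Pol.meet]
      rw [this]
      exact Pol.le_meet (ha i) (hb i)
    · exact (hf _ _ fun i => (ε i).meet_le_left _ _).trans hax
    · exact (hf _ _ fun i => (ε i).meet_le_right _ _).trans hby
  obtain ⟨x, ⟨a, ha, hax⟩, hx⟩ := exists_upperBound_of_finite hne hmeet hfin hS'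
  refine ⟨a, ha, le_trans (le_sInf ?_) (hle'.trans (sSup_le_sSup (Set.image_mono hT')))⟩
  rintro _ ⟨t, ht, rfl⟩
  exact OrderHomClass.mono e (hax.trans (hx t ht))

/-- The `σ`-extension preserves nonempty joins in each coordinate. -/
theorem sigmaExt_coordJoin (he : IsCanonicalExtension e)
    (hf : ∀ a i x y, f (update a i ((ε i).join x y)) = f (update a i x) ⊔ f (update a i y)) :
    CoordJoin ε (sigmaExt e ε f) := by
  intro u i X b hX hb
  have hm : OrdMono ε f := ordMono_of_join hf
  -- Meet-density allows `b` to be replaced by an open `o` above it, against which compactness can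
  -- be applied.
  refine he.le_of_forall_open fun o ho hbo => ?_
  refine sSup_le ?_
  rintro _ ⟨k, hk, hku, rfl⟩
  -- The possible `i`th entries of tuples of `A` that lie above `k` in the other coordinates and
  -- whose `f`-value is below `o`. It remains to find such an entry above `k i`.
  set I : Set A := {x | ∃ c : Fin n → A, c i = x ∧
    (∀ j, j ≠ i → (ε j).le (k j) (e (c j))) ∧ e (f c) ≤ o}
  have mem_I : ∀ x ∈ X, ∀ k', (ε i).IsClosed e k' → (ε i).le k' x →
      ∃ y ∈ I, (ε i).le k' (e y) := by
    intro x hx k' hk' hkx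
    have hle : sigmaClosed e ε f (update k i k') ≤ sigmaExt e ε f (update u i x) := by
      refine le_sSup ⟨update k i k', fun j => ?_, ?_, rfl⟩
      · rcases eq_or_ne j i with rfl | hj
        · simpa using hk'
        · simpa [hj] using hk j
      · exact update_le_update (fun j hj => by simpa [hj] using hku j) hkx
    obtain ⟨c, hc, hco⟩ := exists_le_of_sigmaClosed_le he hm ho
      (hle.trans ((hb x hx).trans hbo))
    refine ⟨c i, ⟨c, rfl, fun j hj => by simpa [hj] using hc j, hco⟩, by simpa using hc i⟩
  have hne : I.Nonempty := by
    obtain ⟨x, hx⟩ := hX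
    obtain ⟨y, hy, -⟩ := mem_I x hx _ ((ε i).isClosed_bot e) ((ε i).bot_le x)
    exact ⟨y, hy⟩
  have hjoin : ∀ x ∈ I, ∀ y ∈ I, (ε i).join x y ∈ I := by
    rintro _ ⟨c, rfl, hc, hco⟩ _ ⟨d, rfl, hd, hdo⟩
    -- Meets in the other coordinates keep the tuple above `k`; the join in coordinate `i` is split
    -- by `hf` into two values, bounded by `f c` and `f d`.
    refine ⟨update (fun j => (ε j).meet (c j) (d j)) i ((ε i).join (c i) (d i)), by simp, ?_, ?_⟩
    · intro j hj
      have : e ((ε j).meet (c j) (d j)) = (ε j).meet (e (c j)) (e (d j)) := by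
        cases ε j <;> simp [Pol.meet]
      simpa [hj, this] using Pol.le_meet (hc j hj) (hd j hj)
    · rw [hf, map_sup]
      refine sup_le (le_trans (OrderHomClass.mono e (hm _ _ ?_)) hco)
        (le_trans (OrderHomClass.mono e (hm _ _ ?_)) hdo)
      · intro j
        simpa using update_le_update (b := c) (fun j _ => (ε j).meet_le_left (c j) (d j))
          ((ε i).le_refl (c i)) j
      · intro j
        simpa using update_le_update (b := d) (fun j _ => (ε j).meet_le_right (c j) (d j))
          ((ε i).le_refl (d i)) j
  -- Each `x ∈ X` is the join of the closed elements below it, and each of those is below a member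
  -- of `I`; hence `k i`, being below the join of `X`, is below the join of `I`.
  have hle : (ε i).le (k i) ((ε i).sup (e '' I)) := by
    refine Pol.le_trans (by simpa using hku i) (Pol.sup_le fun x hx => ?_)
    rw [← he.sup_closed (ε i) x]
    refine Pol.sup_le fun k' hk' => ?_
    obtain ⟨y, hy, hky⟩ := mem_I x hx k' hk'.1 hk'.2
    exact Pol.le_trans hky (Pol.le_sup ⟨y, hy, rfl⟩)
  -- Second use of compactness: `k i` lies below a single member of `I`, whose witness `c` is then
  -- above `k` in every coordinate.
  obtain ⟨_, ⟨c, rfl, hc, hco⟩, hkc⟩ := he.exists_mem_of_le_sup (hk i) hne hjoin hle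
  refine le_trans (sInf_le ⟨c, fun j => ?_, rfl⟩) hco
  rcases eq_or_ne j i with rfl | hj
  exacts [hkc, hc j hj]

/-- A tuple `k` below the argument lies below the tuple of `A` that is bottom at `i` and top
elsewhere, where `f` takes the value `⊥`. -/
lemma sigmaExt_bot (he : ∀ a i, f (update a i (ε i).bot) = ⊥) (u : Fin n → C) (i : Fin n) :
    sigmaExt e ε f (update u i (ε i).bot) = ⊥ := by
  refine le_bot_iff.1 (sSup_le ?_)
  rintro _ ⟨k, -, hku, rfl⟩
  refine sInf_le ⟨update (fun j => (ε j).top) i (ε i).bot, fun j => ?_, by rw [he, map_bot]⟩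
  rcases eq_or_ne j i with rfl | hj
  · have : e (ε j).bot = (ε j).bot := by cases ε j <;> simp [Pol.bot]
    simpa [this] using hku j
  · have : e (ε j).top = (ε j).top := by cases ε j <;> simp [Pol.top]
    simpa [this, hj] using (ε j).le_top _

/-! ### The π-extension by order duality -/

section Dual

open OrderDual

lemma Pol.le_orderDual {X : Type*} [LE X] (ε : Pol) {x y : X} :
    ε.le (toDual x) (toDual y) ↔ ε.le y x := by
  cases ε <;> rfl

lemma Pol.isClosed_dual (ε : Pol) (u : C) :
    ε.IsClosed (BoundedLatticeHom.dual e) (toDual u) ↔ ε.IsOpen e u := by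
  cases ε <;> rfl

lemma IsCanonicalExtension.dual (he : IsCanonicalExtension e) :
    IsCanonicalExtension (BoundedLatticeHom.dual e) where
  injective := he.injective
  dense_join := he.dense_meet
  dense_meet := he.dense_join
  compact S T h := by
    obtain ⟨T', hT, S', hS, fT, fS, hle⟩ := he.compact T S h
    exact ⟨S', hS, T', hT, fS, fT, hle⟩

/-- Domain and codomain are dualized together, so the order-type `ε` stays the same while closed and
open tuples are interchanged. -/
lemma piExt_eq (g : (Fin n → A) → A) (u : Fin n → C) :
    toDual (piExt e ε g u) = sigmaExt (BoundedLatticeHom.dual e) ε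
      (fun a : Fin n → Aᵒᵈ => toDual (g fun i => ofDual (a i))) (fun i => toDual (u i)) := by
  have key : ∀ o : Fin n → C, toDual (piOpen e ε g o) = sigmaClosed (BoundedLatticeHom.dual e) ε
      (fun a : Fin n → Aᵒᵈ => toDual (g fun i => ofDual (a i))) (fun i => toDual (o i)) := by
    intro o
    refine congrArg (fun X : Set C => toDual (sSup X)) (Set.ext fun x => exists_congr fun a => ?_)
    exact and_congr (forall_congr' fun i => ((ε i).le_orderDual (X := C)).symm) Iff.rfl
  refine congrArg (fun X : Set C => toDual (sInf X)) (Set.ext fun x => exists_congr fun o => ?_)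
  refine and_congr (forall_congr' fun i => ((ε i).isClosed_dual _).symm)
    (and_congr (forall_congr' fun i => ((ε i).le_orderDual (X := C)).symm) ?_)
  exact ⟨fun h => h.trans (key o), fun h => h.trans (key o).symm⟩

variable {g : (Fin n → A) → A}

lemma piExt_ordMono (e : BoundedLatticeHom A C) (ε : Fin n → Pol) (g : (Fin n → A) → A) :
    OrdMono ε (piExt e ε g) := by
  intro a b hab
  refine sInf_le_sInf ?_
  rintro _ ⟨k, hk, hka, rfl⟩
  exact ⟨k, hk, fun i => Pol.le_trans (hab i) (hka i), rfl⟩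

lemma toDual_update {X : Type*} (u : Fin n → X) (i : Fin n) (x : X) :
    (fun j => toDual (update u i x j)) = update (fun j => toDual (u j)) i (toDual x) := by
  ext j
  rcases eq_or_ne j i with rfl | hj <;> simp [*]

lemma ofDual_update {X : Type*} (u : Fin n → Xᵒᵈ) (i : Fin n) (x : Xᵒᵈ) :
    (fun j => ofDual (update u i x j)) = update (fun j => ofDual (u j)) i (ofDual x) := by
  ext j
  rcases eq_or_ne j i with rfl | hj <;> simp [*]

/-- The `π`-extension preserves nonempty meets in each coordinate. -/
theorem piExt_coordMeet (he : IsCanonicalExtension e)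
    (hg : ∀ a i x y, g (update a i ((ε i).meet x y)) = g (update a i x) ⊓ g (update a i y)) :
    CoordMeet ε (piExt e ε g) := by
  intro u i X b hX hb
  have hd := sigmaExt_coordJoin (ε := ε) he.dual
    (f := fun a : Fin n → Aᵒᵈ => toDual (g fun i => ofDual (a i))) (by
      intro a i x y
      have : ofDual ((ε i).join x y) = (ε i).meet (ofDual x) (ofDual y) := by cases ε i <;> rfl
      simp only [ofDual_update, this, hg]
      rfl)
  have hs : toDual ((ε i).inf X) = (ε i).sup (toDual '' X) := by
    cases ε i
    · rw [OrderDual.toDual.image_eq_preimage_symm]; rfl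
    · rw [OrderDual.toDual.image_eq_preimage_symm]; rfl
  have := hd (fun j => toDual (u j)) i (toDual '' X) (toDual b) (hX.image _) (by
    rintro _ ⟨x, hx, rfl⟩
    rw [← toDual_update, ← piExt_eq]
    exact hb x hx)
  rw [← hs, ← toDual_update, ← piExt_eq] at this
  exact this

lemma piExt_top (hg : ∀ a i, g (update a i (ε i).top) = ⊤) (u : Fin n → C) (i : Fin n) :
    piExt e ε g (update u i (ε i).top) = ⊤ := by
  refine top_le_iff.1 (le_sInf ?_)
  rintro _ ⟨k, -, hku, rfl⟩
  refine le_sSup ⟨update (fun j => (ε j).bot) i (ε i).top, fun j => ?_, by rw [hg, map_top]⟩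
  rcases eq_or_ne j i with rfl | hj
  · have : e (ε j).top = (ε j).top := by cases ε j <;> simp [Pol.top]
    simpa [this] using hku j
  · have : e (ε j).bot = (ε j).bot := by cases ε j <;> simp [Pol.bot]
    simpa [this, hj] using (ε j).bot_le _

end Dual

end Canonical

end ALBA

/-! ### Monotonicity of the expanded language; values of formulas and contexts -/

namespace ALBA

open Function

variable {L : Sig.{u}} {V : Type} {C : Type w}

/-- All operations are monotone with respect to the order-types of the connectives. -/
structure Ops.Mono [LE C] (O : Ops L C) : Prop where
  opF : ∀ f, OrdMono (L.otF f) (O.opF f)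
  opG : ∀ g, OrdMono (L.otG g) (O.opG g)

section TenseOps

variable [CompleteLattice C] {O : Ops L C}

/-- Normalizing lowers the value only at the bottom tuple, and below that tuple there is nothing
else. -/
lemma Ops.Mono.normF (hO : O.Mono) (f : L.F) : OrdMono (L.otF f) (O.normF f) := by
  intro a b hab
  unfold Ops.normF
  split_ifs with ha hb hb
  · exact le_rfl
  · exact bot_le
  · exact absurd (fun i => Pol.eq_bot_of_le (hb i ▸ hab i)) ha
  · exact hO.opF f a b hab

lemma Ops.Mono.normG (hO : O.Mono) (g : L.G) : OrdMono (L.otG g) (O.normG g) := by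
  intro a b hab
  unfold Ops.normG
  split_ifs with ha hb hb
  · exact le_rfl
  · exact absurd (fun i => Pol.eq_top_of_le (ha i ▸ hab i)) hb
  · exact le_top
  · exact hO.opG g a b hab

lemma Ops.Mono.primeF (hO : O.Mono) (f : L.F) : OrdMono (L.otF f) (O.primeF f) := by
  unfold Ops.primeF
  split_ifs
  exacts [hO.normF f, hO.opF f]

lemma Ops.Mono.primeG (hO : O.Mono) (g : L.G) : OrdMono (L.otG g) (O.primeG g) := by
  unfold Ops.primeG
  split_ifs
  exacts [hO.normG g, hO.opG g]

/-- Enlarging the arguments in the order-type of a residual shrinks the set defining it when it is a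
meet (`F*`) and enlarges that set when it is a join (`G*`). No adjunction property is involved. -/
lemma Ops.Mono.star (hO : O.Mono) : O.star.Mono where
  opF
    | StarF.base f => hO.opF f
    | StarF.norm f _ => hO.normF f
    | StarF.sharp f i h => fun (a b : Fin (L.arF f) → C) hab => by
        refine sInf_le_sInf fun c hc => le_trans (hO.primeF f _ _ ?_) (le_trans hc ?_)
        · refine update_le_update (fun j hj => ?_) (Pol.le_refl _ c)
          simpa [Sig.star, hj] using hab j
        · simpa [Sig.star, Pol.le] using hab i
    | StarF.flat g i h => fun (a b : Fin (L.arG g) → C) hab => by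
        refine sInf_le_sInf fun c hc => le_trans ?_ (le_trans hc (hO.primeG g _ _ ?_))
        · simpa [Sig.star, Pol.le] using hab i
        · refine update_le_update (fun j hj => ?_) (Pol.le_refl _ c)
          simpa [Sig.star, hj, Pol.le_dual_iff] using hab j
  opG
    | StarG.base g => hO.opG g
    | StarG.norm g _ => hO.normG g
    | StarG.sharp f i h => fun (a b : Fin (L.arF f) → C) hab => by
        refine sSup_le_sSup fun c hc => le_trans (hO.primeF f _ _ ?_) (le_trans hc ?_)
        · refine update_le_update (fun j hj => ?_) (Pol.le_refl _ c)
          simpa [Sig.star, hj, Pol.le_dual_iff] using hab j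
        · simpa [Sig.star, Pol.le] using hab i
    | StarG.flat g i h => fun (a b : Fin (L.arG g) → C) hab => by
        refine sSup_le_sSup fun c hc => le_trans ?_ (le_trans hc (hO.primeG g _ _ ?_))
        · simpa [Sig.star, Pol.le] using hab i
        · refine update_le_update (fun j hj => ?_) (Pol.le_refl _ c)
          simpa [Sig.star, hj] using hab j

end TenseOps

namespace Fm

section Eval

variable [Lattice C] [BoundedOrder C] {O : Ops L C}

lemma eval_congr {val val' : V → C} {t : Fm L V} (h : ∀ x, t.Occurs x → val x = val' x) :
    t.eval O val = t.eval O val' := by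
  induction t with
  | var x => exact h x rfl
  | bot => rfl
  | top => rfl
  | and s t hs ht =>
    exact congrArg₂ (· ⊓ ·) (hs fun x hx => h x (Or.inl hx)) (ht fun x hx => h x (Or.inr hx))
  | or s t hs ht =>
    exact congrArg₂ (· ⊔ ·) (hs fun x hx => h x (Or.inl hx)) (ht fun x hx => h x (Or.inr hx))
  | opF f args ih => exact congrArg _ (funext fun i => ih i fun x hx => h x ⟨i, hx⟩)
  | opG g args ih => exact congrArg _ (funext fun i => ih i fun x hx => h x ⟨i, hx⟩)

lemma eval_update_of_not_occurs [DecidableEq V] {val : V → C} {t : Fm L V} {x : V}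
    (h : ¬ t.Occurs x) (c : C) : t.eval O (update val x c) = t.eval O val :=
  eval_congr fun y hy => update_of_ne (by rintro rfl; exact h hy) _ _

lemma eval_subst [DecidableEq V] (val : V → C) (x : V) (r t : Fm L V) :
    (subst x r t).eval O val = t.eval O (update val x (r.eval O val)) := by
  induction t with
  | var y =>
    by_cases h : y = x
    · subst h; simp [subst, eval]
    · simp [subst, eval, h]
  | bot => rfl
  | top => rfl
  | and s t hs ht => exact congrArg₂ (· ⊓ ·) hs ht
  | or s t hs ht => exact congrArg₂ (· ⊔ ·) hs ht
  | opF f args ih => exact congrArg _ (funext ih)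
  | opG g args ih => exact congrArg _ (funext ih)

/-- Monotonicity of the value of `t` in a variable `x` none of whose leaves is signed `s'`. -/
lemma eval_le_eval (hO : O.Mono) {val val' : V → C} {x : V} (hne : ∀ y, y ≠ x → val y = val' y)
    {s' : Pol} (hx : s'.le (val' x) (val x)) {s : Pol} {t : Fm L V} (h : ¬ HasLeaf s' x s t) :
    s.le (t.eval O val) (t.eval O val') := by
  induction t generalizing s with
  | var y =>
    rcases eq_or_ne y x with rfl | hy
    · have : s ≠ s' := fun hs => h ⟨rfl, hs⟩
      -- The leaf is signed opposite to `s'`, so `hx` is the required inequality read in the order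
      -- of `s`.
      cases s <;> cases s' <;> first | exact absurd rfl this | exact hx
    · simpa [eval, hne y hy] using s.le_refl (val' y)
  | bot => exact s.le_refl _
  | top => exact s.le_refl _
  | and t₁ t₂ h₁ h₂ =>
    have i₁ := h₁ fun h' => h (Or.inl h')
    have i₂ := h₂ fun h' => h (Or.inr h')
    cases s
    exacts [inf_le_inf i₁ i₂, inf_le_inf i₁ i₂]
  | or t₁ t₂ h₁ h₂ =>
    have i₁ := h₁ fun h' => h (Or.inl h')
    have i₂ := h₂ fun h' => h (Or.inr h')
    cases s
    exacts [sup_le_sup i₁ i₂, sup_le_sup i₁ i₂]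
  | opF f args ih =>
    have ih' := fun i => ih i (s := s.child (L.otF f i)) fun h' => h ⟨i, h'⟩
    cases s
    · exact hO.opF f _ _ fun i => by simpa using ih' i
    · exact hO.opF f _ _ fun i => by simpa [Pol.le_dual_iff] using ih' i
  | opG g args ih =>
    have ih' := fun i => ih i (s := s.child (L.otG g i)) fun h' => h ⟨i, h'⟩
    cases s
    · exact hO.opG g _ _ fun i => by simpa using ih' i
    · exact hO.opG g _ _ fun i => by simpa [Pol.le_dual_iff] using ih' i

lemma eval_bigOr_le_iff {val : V → C} {l : List (Fm L V)} {b : C} :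
    (bigOr l).eval O val ≤ b ↔ ∀ t ∈ l, t.eval O val ≤ b := by
  induction l with
  | nil => simp [bigOr, eval]
  | cons t l ih =>
    cases l with
    | nil => simp [bigOr]
    | cons t' l => simpa [bigOr, eval] using fun _ => ih

lemma le_eval_bigAnd_iff {val : V → C} {l : List (Fm L V)} {b : C} :
    b ≤ (bigAnd l).eval O val ↔ ∀ t ∈ l, b ≤ t.eval O val := by
  induction l with
  | nil => simp [bigAnd, eval]
  | cons t l ih =>
    cases l with
    | nil => simp [bigAnd]
    | cons t' l => simpa [bigAnd, eval] using fun _ => ih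

end Eval

/-- The connectives of the formula belong to the original signature. -/
def IsBase : Fm L.star V → Prop
  | var _ => True
  | bot => True
  | top => True
  | and s t => s.IsBase ∧ t.IsBase
  | or s t => s.IsBase ∧ t.IsBase
  | opF f args => (∃ f' : L.F, f = StarF.base f') ∧ ∀ i, (args i).IsBase
  | opG g args => (∃ g' : L.G, g = StarG.base g') ∧ ∀ i, (args i).IsBase

lemma isBase_toPlus (t : BaseFm L) : t.toPlus.IsBase := by
  induction t with
  | var x => trivial
  | bot => trivial
  | top => trivial
  | and s t hs ht => exact ⟨hs, ht⟩
  | or s t hs ht => exact ⟨hs, ht⟩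
  | opF f args ih => exact ⟨⟨f, rfl⟩, ih⟩
  | opG g args ih => exact ⟨⟨g, rfl⟩, ih⟩

lemma eval_toPlus [CompleteLattice C] (O : Ops L C) (val : PVar → C) (t : BaseFm L) :
    t.toPlus.eval O.star val = t.eval O fun p => val (PVar.prop p) := by
  induction t with
  | var x => rfl
  | bot => rfl
  | top => rfl
  | and s t hs ht => exact congrArg₂ (· ⊓ ·) hs ht
  | or s t hs ht => exact congrArg₂ (· ⊔ ·) hs ht
  | opF f args ih => exact congrArg (O.opF f) (funext ih)
  | opG g args ih => exact congrArg (O.opG g) (funext ih)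

end Fm

namespace Ctx

lemma isBase_fill {c : Ctx L.star V} {r r' : Fm L.star V} (h : (c.fill r).IsBase)
    (h' : r'.IsBase) : (c.fill r').IsBase := by
  induction c with
  | hole => exact h'
  | andL c t ih => exact ⟨ih h.1, h.2⟩
  | andR t c ih => exact ⟨h.1, ih h.2⟩
  | orL c t ih => exact ⟨ih h.1, h.2⟩
  | orR t c ih => exact ⟨h.1, ih h.2⟩
  | opF f i args c ih =>
    refine ⟨h.1, fun j => ?_⟩
    have hj := h.2 j
    rcases eq_or_ne j i with rfl | hji
    · simp only [update_self] at hj ⊢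
      exact ih hj
    · simpa [hji] using hj
  | opG g i args c ih =>
    refine ⟨h.1, fun j => ?_⟩
    have hj := h.2 j
    rcases eq_or_ne j i with rfl | hji
    · simp only [update_self] at hj ⊢
      exact ih hj
    · simpa [hji] using hj

section Eval

variable [Lattice C] [BoundedOrder C] {O : Ops L C}

/-- The value of `φ(!x)` when the placeholder takes the value `b`. -/
def eval (O : Ops L C) (val : V → C) (b : C) : Ctx L V → C
  | hole => b
  | andL c t => c.eval O val b ⊓ t.eval O val
  | andR t c => t.eval O val ⊓ c.eval O val b
  | orL c t => c.eval O val b ⊔ t.eval O val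
  | orR t c => t.eval O val ⊔ c.eval O val b
  | opF f i args c => O.opF f (update (fun j => (args j).eval O val) i (c.eval O val b))
  | opG g i args c => O.opG g (update (fun j => (args j).eval O val) i (c.eval O val b))

lemma eval_fill (val : V → C) (c : Ctx L V) (r : Fm L V) :
    (c.fill r).eval O val = c.eval O val (r.eval O val) := by
  induction c with
  | hole => rfl
  | andL c t ih => exact congrArg (· ⊓ _) ih
  | andR t c ih => exact congrArg (_ ⊓ ·) ih
  | orL c t ih => exact congrArg (· ⊔ _) ih
  | orR t c ih => exact congrArg (_ ⊔ ·) ih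
  | opF f i args c ih =>
    refine congrArg (O.opF f) (funext fun j => ?_)
    rcases eq_or_ne j i with rfl | hj
    · simpa using ih
    · simp [hj]
  | opG g i args c ih =>
    refine congrArg (O.opG g) (funext fun j => ?_)
    rcases eq_or_ne j i with rfl | hj
    · simpa using ih
    · simp [hj]

/-- Occurrence is tested in the filled context, as freshness of a nominal is known only for the
whole formula; the overwritten `args i` thus imposes no condition. -/
lemma eval_congr {val val' : V → C} {c : Ctx L V} {r : Fm L V}
    (h : ∀ x, (c.fill r).Occurs x → val x = val' x) (b : C) :
    c.eval O val b = c.eval O val' b := by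
  induction c with
  | hole => rfl
  | andL c t ih =>
    exact congrArg₂ _ (ih fun x hx => h x (Or.inl hx)) (Fm.eval_congr fun x hx => h x (Or.inr hx))
  | andR t c ih =>
    exact congrArg₂ _ (Fm.eval_congr fun x hx => h x (Or.inl hx)) (ih fun x hx => h x (Or.inr hx))
  | orL c t ih =>
    exact congrArg₂ _ (ih fun x hx => h x (Or.inl hx)) (Fm.eval_congr fun x hx => h x (Or.inr hx))
  | orR t c ih =>
    exact congrArg₂ _ (Fm.eval_congr fun x hx => h x (Or.inl hx)) (ih fun x hx => h x (Or.inr hx))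
  | opF f i args c ih =>
    refine congrArg (O.opF f) (funext fun j => ?_)
    rcases eq_or_ne j i with rfl | hj
    · simpa using ih fun x hx => h x ⟨j, by simpa using hx⟩
    · simpa [hj] using Fm.eval_congr fun x hx => h x ⟨j, by simpa [hj] using hx⟩
  | opG g i args c ih =>
    refine congrArg (O.opG g) (funext fun j => ?_)
    rcases eq_or_ne j i with rfl | hj
    · simpa using ih fun x hx => h x ⟨j, by simpa using hx⟩
    · simpa [hj] using Fm.eval_congr fun x hx => h x ⟨j, by simpa [hj] using hx⟩

lemma eval_le_eval (hO : O.Mono) (val : V → C) {c : Ctx L V} {s : Pol} {b b' : C}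
    (h : (c.holeSign s).le b b') : s.le (c.eval O val b) (c.eval O val b') := by
  induction c generalizing s with
  | hole => exact h
  | andL c t ih =>
    have := ih h
    cases s
    exacts [inf_le_inf_right _ this, inf_le_inf_right _ this]
  | andR t c ih =>
    have := ih h
    cases s
    exacts [inf_le_inf_left _ this, inf_le_inf_left _ this]
  | orL c t ih =>
    have := ih h
    cases s
    exacts [sup_le_sup_right this _, sup_le_sup_right this _]
  | orR t c ih =>
    have := ih h
    cases s
    exacts [sup_le_sup_left this _, sup_le_sup_left this _]
  | opF f i args c ih =>
    have := ih h
    cases s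
    · exact (hO.opF f).update _ (by simpa using this)
    · exact (hO.opF f).update _ (by simpa [Pol.le_dual_iff] using this)
  | opG g i args c ih =>
    have := ih h
    cases s
    · exact (hO.opG g).update _ (by simpa using this)
    · exact (hO.opG g).update _ (by simpa [Pol.le_dual_iff] using this)

end Eval

/-- A SAC branch preserves nonempty joins (in the signed orders). -/
lemma eval_sup_le [CompleteLattice C] {O : Ops L C} (hO : O.Mono)
    (hF : ∀ f, CoordJoin (L.otF f) (O.opF f)) (hG : ∀ g, CoordMeet (L.otG g) (O.opG g))
    (val : V → C) {c : Ctx L.star V} {r : Fm L.star V} (hb : (c.fill r).IsBase) {s : Pol}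
    (hc : c.IsSAC s) {X : Set C} (hX : X.Nonempty) :
    s.le (c.eval O.star val ((c.holeSign s).sup X)) (s.sup (c.eval O.star val '' X)) := by
  induction c generalizing s with
  | hole =>
    have h : (hole : Ctx L.star V).eval O.star val '' X = X := Set.image_id X
    rw [h]
    exact s.le_refl _
  | andL c t ih => exact hc.elim
  | andR t c ih => exact hc.elim
  | orL c t ih => exact hc.elim
  | orR t c ih => exact hc.elim
  | opF f i args c ih =>
    -- Since the filled formula is base, the node is an original connective, to which `hF` applies.
    obtain ⟨⟨f, rfl⟩, hargs⟩ := hb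
    obtain ⟨rfl, hc⟩ := hc
    have hi := hargs i
    rw [update_self] at hi
    have hle := ih hi hc
    refine le_trans ((hO.opF f).update _ (Pol.le_sup_child_pos.1 hle)) (hF f _ i _ _ (hX.image _) ?_)
    rintro _ ⟨x, hx, rfl⟩
    exact le_sSup ⟨x, hx, rfl⟩
  | opG g i args c ih =>
    obtain ⟨⟨g, rfl⟩, hargs⟩ := hb
    obtain ⟨rfl, hc⟩ := hc
    have hi := hargs i
    rw [update_self] at hi
    have hle := ih hi hc
    refine le_trans (hG g _ i _ _ (hX.image _) ?_) ((hO.opG g).update _ (Pol.le_sup_child_neg.1 hle))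
    rintro _ ⟨x, hx, rfl⟩
    exact sInf_le ⟨x, hx, rfl⟩

end Ctx

end ALBA

/-! ### Truth under a fixed assignment: splitting, residuation, distribution -/

namespace ALBA

open Function

variable {L : Sig.{u}} {C : Type w} [CompleteLattice C]

/-- Complete operators and dual operators, normal or regular in each coordinate. -/
structure Ops.IsComplete (O : Ops L C) : Prop extends O.Mono where
  join : ∀ f, CoordJoin (L.otF f) (O.opF f)
  meet : ∀ g, CoordMeet (L.otG g) (O.opG g)
  bot : ∀ f, ¬ L.regF f → ∀ i a, O.opF f (update a i (L.otF f i).bot) = ⊥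
  top : ∀ g, ¬ L.regG g → ∀ i a, O.opG g (update a i (L.otG g i).top) = ⊤

lemma canOps_isComplete {A : Type v} [Lattice A] [BoundedOrder A] (𝔸 : LatticeExpansion L A)
    {e : BoundedLatticeHom A C} (he : IsCanonicalExtension e) : (canOps 𝔸 e).IsComplete where
  opF _ := sigmaExt_ordMono e _ _
  opG _ := piExt_ordMono e _ _
  join f := sigmaExt_coordJoin he fun a i => 𝔸.opF_join f i a
  meet g := piExt_coordMeet he fun a i => 𝔸.opG_meet g i a
  bot f hf i a := sigmaExt_bot (fun b j => 𝔸.opF_bot f hf j b) a i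
  top g hg i a := piExt_top (fun b j => 𝔸.opG_top g hg j b) a i

lemma Fm.eval_update_args {V : Type} {X : Type*} [Lattice X] [BoundedOrder X] {M : Sig.{u}}
    (O : Ops M X) (val : V → X) {n : ℕ} (args : Fin n → Fm M V) (i : Fin n) (t : Fm M V) :
    (fun j => (update args i t j).eval O val)
      = update (fun j => (args j).eval O val) i (t.eval O val) := by
  ext j
  rcases eq_or_ne j i with rfl | hj <;> simp [*]

lemma SplitRule.holds_iff {V : Type} {M : Sig.{u}} {O : Ops M C} {r : Ineq M V} {D : Set (Ineq M V)}
    (h : SplitRule r D) (val : V → C) : r.Holds O val ↔ ∀ q ∈ D, q.Holds O val := by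
  cases h with
  | and α β γ => simp [Ineq.Holds, Fm.eval]
  | or α β γ => simp [Ineq.Holds, Fm.eval]

lemma Ineq.holds_subst {V : Type} [DecidableEq V] {M : Sig.{u}} {O : Ops M C}
    (q : Ineq M V) (x : V) (r : Fm M V) (val : V → C) :
    (q.subst x r).Holds O val ↔ q.Holds O (update val x (r.eval O val)) := by
  simp [Ineq.Holds, Ineq.subst, Fm.eval_subst]

/-- An inequality with positive left and negative right side is inherited by smaller values. -/
lemma Ineq.Holds.of_le {V : Type} {M : Sig.{u}} {O : Ops M C} (hO : O.Mono)
    {q : Ineq M V} {x : V} (hl : q.lhs.Positive x) (hr : q.rhs.Negative x) {val val' : V → C}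
    (hne : ∀ y, y ≠ x → val y = val' y) (hx : val x ≤ val' x) (h : q.Holds O val') :
    q.Holds O val :=
  (Fm.eval_le_eval (s' := Pol.neg) hO hne hx hl).trans
    (h.trans (Fm.eval_le_eval (s' := Pol.pos) hO (fun y hy => (hne y hy).symm) hx hr))

/-- An inequality with negative left and positive right side is inherited by larger values. -/
lemma Ineq.Holds.of_ge {V : Type} {M : Sig.{u}} {O : Ops M C} (hO : O.Mono)
    {q : Ineq M V} {x : V} (hl : q.lhs.Negative x) (hr : q.rhs.Positive x) {val val' : V → C}
    (hne : ∀ y, y ≠ x → val y = val' y) (hx : val' x ≤ val x) (h : q.Holds O val') :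
    q.Holds O val :=
  (Fm.eval_le_eval (s' := Pol.pos) hO hne hx hl).trans
    (h.trans (Fm.eval_le_eval (s' := Pol.neg) hO (fun y hy => (hne y hy).symm) hx hr))

lemma Ineq.holds_update_of_not_occurs {V : Type} [DecidableEq V] {M : Sig.{u}} {O : Ops M C}
    {q : Ineq M V} {x : V} (h : ¬ q.Occurs x) (val : V → C) (c : C) :
    q.Holds O (update val x c) ↔ q.Holds O val := by
  simp only [Ineq.Occurs, not_or] at h
  simp [Ineq.Holds, Fm.eval_update_of_not_occurs h.1, Fm.eval_update_of_not_occurs h.2]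

namespace Ops.IsComplete

variable {O : Ops L C}

lemma opF_le_iff (hO : O.IsComplete) {f : L.F} (hf : ¬ L.regF f) (i : Fin (L.arF f))
    (a : Fin (L.arF f) → C) (b : C) :
    O.opF f a ≤ b ↔
      (L.otF f i).le (a i) ((L.otF f i).sup {c | O.primeF f (update a i c) ≤ b}) := by
  rw [(hO.join f).le_iff (hO.opF f) (i := i) (by rw [hO.bot f hf]; exact bot_le)]
  simp [Ops.primeF, hf]

lemma le_opG_iff (hO : O.IsComplete) {g : L.G} (hg : ¬ L.regG g) (i : Fin (L.arG g))
    (a : Fin (L.arG g) → C) (b : C) :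
    b ≤ O.opG g a ↔
      (L.otG g i).le ((L.otG g i).inf {c | b ≤ O.primeG g (update a i c)}) (a i) := by
  rw [(hO.meet g).le_iff (hO.opG g) (i := i) (by rw [hO.top g hg]; exact le_top)]
  simp [Ops.primeG, hg]

/-- The normalization differs from `f` only at the bottom. Once `f(⊥) ≤ b` is known, both have the
same arguments with value below `b`, and this set is nonempty, so residuation applies to `f` itself.
-/
lemma opF_le_iff_of_reg (hO : O.IsComplete) {f : L.F} (hf : L.regF f) (i : Fin (L.arF f))
    (a b : C) :
    O.opF f (fun _ => a) ≤ b ↔ O.opF f (fun _ => (L.otF f i).bot) ≤ b ∧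
      (L.otF f i).le a
        ((L.otF f i).sup {c | O.primeF f (update (fun _ => b) i c) ≤ b}) := by
  have hsub : ∀ j, j = i := by
    intro j
    have h1 := L.unaryF f hf
    exact Fin.ext (by omega)
  have hupd : ∀ (a' : Fin (L.arF f) → C) c, update a' i c = fun _ => c := by
    intro a' c
    ext j
    rw [hsub j, update_self]
  have key : ∀ (h : O.opF f (fun _ => (L.otF f i).bot) ≤ b) (c : C),
      O.primeF f (fun _ => c) ≤ b ↔ O.opF f (fun _ => c) ≤ b := by
    intro h c
    simp only [Ops.primeF, hf, if_true, Ops.normF]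
    split_ifs with hc
    · have : c = (L.otF f i).bot := hc i
      simp [this, h]
    · rfl
  have hmono : O.opF f (fun _ => a) ≤ b → O.opF f (fun _ => (L.otF f i).bot) ≤ b :=
    le_trans (hO.opF f _ _ fun j => by rw [hsub j]; exact Pol.bot_le _ _)
  simp only [hupd]
  constructor
  · intro h
    refine ⟨hmono h, ?_⟩
    simp only [key (hmono h)]
    exact Pol.le_sup h
  · rintro ⟨h, hle⟩
    simp only [key h] at hle
    rw [(hO.join f).le_iff (hO.opF f) (i := i) (by rwa [hupd])]
    simpa only [hupd] using hle

lemma le_opG_iff_of_reg (hO : O.IsComplete) {g : L.G} (hg : L.regG g) (i : Fin (L.arG g))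
    (a b : C) :
    b ≤ O.opG g (fun _ => a) ↔ b ≤ O.opG g (fun _ => (L.otG g i).top) ∧
      (L.otG g i).le
        ((L.otG g i).inf {c | b ≤ O.primeG g (update (fun _ => b) i c)}) a := by
  have hsub : ∀ j, j = i := by
    intro j
    have h1 := L.unaryG g hg
    exact Fin.ext (by omega)
  have hupd : ∀ (a' : Fin (L.arG g) → C) c, update a' i c = fun _ => c := by
    intro a' c
    ext j
    rw [hsub j, update_self]
  have key : ∀ (h : b ≤ O.opG g (fun _ => (L.otG g i).top)) (c : C),
      b ≤ O.primeG g (fun _ => c) ↔ b ≤ O.opG g (fun _ => c) := by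
    intro h c
    simp only [Ops.primeG, hg, if_true, Ops.normG]
    split_ifs with hc
    · have : c = (L.otG g i).top := hc i
      simp [this, h]
    · rfl
  have hmono : b ≤ O.opG g (fun _ => a) → b ≤ O.opG g (fun _ => (L.otG g i).top) :=
    fun h => h.trans (hO.opG g _ _ fun j => by rw [hsub j]; exact Pol.le_top _ _)
  simp only [hupd]
  constructor
  · intro h
    refine ⟨hmono h, ?_⟩
    simp only [key (hmono h)]
    exact Pol.inf_le h
  · rintro ⟨h, hle⟩
    simp only [key h] at hle
    rw [(hO.meet g).le_iff (hO.opG g) (i := i) (by rwa [hupd])]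
    simpa only [hupd] using hle

lemma holds_resRule (hO : O.IsComplete) {r : Ineq L.star PVar} {D : Set (Ineq L.star PVar)}
    (h : ResRule r D) (val : PVar → C) :
    r.Holds O.star val ↔ ∀ q ∈ D, q.Holds O.star val := by
  simp only [Ineq.Holds]
  induction h with
  | fPos f hf i h args ψ =>
    have := hO.opF_le_iff hf i (fun j => (args j).eval O.star val) (ψ.eval O.star val)
    rw [h] at this
    simp only [Set.mem_singleton_iff, forall_eq]
    refine this.trans ?_
    -- In the residual, the `i`th argument `ψ` serves only as the bound: inside the set it is
    -- overwritten by `c`, so the two updates collapse.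
    change _ ↔ (args i).eval O.star val ≤ sSup {c | O.primeF f (update (fun j => (update args i ψ j).eval O.star val) i c) ≤
      (update args i ψ i).eval O.star val}
    rw [Fm.eval_update_args, update_self]
    simp only [update_idem]
    rfl
  | fNeg f hf i h args ψ =>
    have := hO.opF_le_iff hf i (fun j => (args j).eval O.star val) (ψ.eval O.star val)
    rw [h] at this
    simp only [Set.mem_singleton_iff, forall_eq]
    refine this.trans ?_
    change _ ↔ sInf {c | O.primeF f (update (fun j => (update args i ψ j).eval O.star val) i c) ≤
      (update args i ψ i).eval O.star val} ≤ (args i).eval O.star val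
    rw [Fm.eval_update_args, update_self]
    simp only [update_idem]
    rfl
  | gPos g hg i h args ψ =>
    have := hO.le_opG_iff hg i (fun j => (args j).eval O.star val) (ψ.eval O.star val)
    rw [h] at this
    simp only [Set.mem_singleton_iff, forall_eq]
    refine this.trans ?_
    change _ ↔ sInf {c | (update args i ψ i).eval O.star val ≤
      O.primeG g (update (fun j => (update args i ψ j).eval O.star val) i c)} ≤ (args i).eval O.star val
    rw [Fm.eval_update_args, update_self]
    simp only [update_idem]
    rfl
  | gNeg g hg i h args ψ =>
    have := hO.le_opG_iff hg i (fun j => (args j).eval O.star val) (ψ.eval O.star val)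
    rw [h] at this
    simp only [Set.mem_singleton_iff, forall_eq]
    refine this.trans ?_
    change _ ↔ (args i).eval O.star val ≤ sSup {c | (update args i ψ i).eval O.star val ≤
      O.primeG g (update (fun j => (update args i ψ j).eval O.star val) i c)}
    rw [Fm.eval_update_args, update_self]
    simp only [update_idem]
    rfl
  | fRegPos f hf i h φ ψ =>
    have := hO.opF_le_iff_of_reg hf i (φ.eval O.star val) (ψ.eval O.star val)
    rw [h] at this
    simp only [Set.mem_insert_iff, Set.mem_singleton_iff, forall_eq_or_imp, forall_eq]
    exact this
  | fRegNeg f hf i h φ ψ =>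
    have := hO.opF_le_iff_of_reg hf i (φ.eval O.star val) (ψ.eval O.star val)
    rw [h] at this
    simp only [Set.mem_insert_iff, Set.mem_singleton_iff, forall_eq_or_imp, forall_eq]
    exact this
  | gRegPos g hg i h φ ψ =>
    have := hO.le_opG_iff_of_reg hg i (ψ.eval O.star val) (φ.eval O.star val)
    rw [h] at this
    simp only [Set.mem_insert_iff, Set.mem_singleton_iff, forall_eq_or_imp, forall_eq]
    exact this
  | gRegNeg g hg i h φ ψ =>
    have := hO.le_opG_iff_of_reg hg i (ψ.eval O.star val) (φ.eval O.star val)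
    rw [h] at this
    simp only [Set.mem_insert_iff, Set.mem_singleton_iff, forall_eq_or_imp, forall_eq]
    exact this

lemma eval_distRule (hO : O.IsComplete) {s : Pol} {t t' : BaseFm L} (h : DistRule s t t')
    (val : ℕ → C) : t.eval O val = t'.eval O val := by
  induction h with
  | fOr f i h args s t =>
    simpa [Fm.eval, Fm.eval_update_args, h, Pol.join] using (hO.join f).map_join (hO.opF f)
      (fun j => (args j).eval O val) i (s.eval O val) (t.eval O val)
  | fAnd f i h args s t =>
    simpa [Fm.eval, Fm.eval_update_args, h, Pol.join] using (hO.join f).map_join (hO.opF f)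
      (fun j => (args j).eval O val) i (s.eval O val) (t.eval O val)
  | gAnd g i h args s t =>
    simpa [Fm.eval, Fm.eval_update_args, h, Pol.meet] using (hO.meet g).map_meet (hO.opG g)
      (fun j => (args j).eval O val) i (s.eval O val) (t.eval O val)
  | gOr g i h args s t =>
    simpa [Fm.eval, Fm.eval_update_args, h, Pol.meet] using (hO.meet g).map_meet (hO.opG g)
      (fun j => (args j).eval O val) i (s.eval O val) (t.eval O val)

end Ops.IsComplete

/-! ### Preservation of validity by the rules and along runs -/

section Rules

variable {A : Type v} [Lattice A] [BoundedOrder A] {𝔸 : LatticeExpansion L A}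
  {e : BoundedLatticeHom A C}

/-- Elimination: one direction instantiates `p` by the constant; conversely, the inequality is
monotone in the value of `p`, and the constant is the least favourable value. -/
lemma validIneq_preRule (he : IsCanonicalExtension e) {q : Ineq L ℕ} {D : Set (Ineq L ℕ)}
    (h : PreRule q D) : ValidIneq 𝔸 e q ↔ ∀ r ∈ D, ValidIneq 𝔸 e r := by
  have hO := canOps_isComplete 𝔸 he
  induction h with
  | elimPos p q hl hr =>
    simp only [Set.mem_singleton_iff, forall_eq]
    constructor
    · exact fun h val => (q.holds_subst _ _ _).2 (h _)
    · exact fun h val => Ineq.Holds.of_ge hO.toMono hl hr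
        (fun y hy => (update_of_ne hy _ _).symm) (by simp [Fm.eval])
        ((q.holds_subst _ _ _).1 (h val))
  | elimNeg p q hl hr =>
    simp only [Set.mem_singleton_iff, forall_eq]
    constructor
    · exact fun h val => (q.holds_subst _ _ _).2 (h _)
    · exact fun h val => Ineq.Holds.of_le hO.toMono hl hr
        (fun y hy => (update_of_ne hy _ _).symm) (by simp [Fm.eval])
        ((q.holds_subst _ _ _).1 (h val))
  | distLeft c t t' ψ h =>
    simp [ValidIneq, Ineq.Holds, Ctx.eval_fill, hO.eval_distRule h]
  | distRight c t t' φ h =>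
    simp [ValidIneq, Ineq.Holds, Ctx.eval_fill, hO.eval_distRule h]
  | split q D h =>
    constructor
    · exact fun hq r hr val => (SplitRule.holds_iff h val).1 (hq val) r hr
    · exact fun hD val => (SplitRule.holds_iff h val).2 fun r hr => hD r hr val

lemma forall_mem_replace {α : Type*} {P : α → Prop} {S D : Set α} {r : α} (hr : r ∈ S)
    (h : P r ↔ ∀ q ∈ D, P q) : (∀ q ∈ S \ {r} ∪ D, P q) ↔ ∀ q ∈ S, P q := by
  constructor
  · intro H q hq
    by_cases hqr : q = r
    · exact hqr ▸ h.2 fun q' hq' => H q' (Or.inr hq')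
    · exact H q (Or.inl ⟨hq, hqr⟩)
  · rintro H q (hq | hq)
    exacts [H q hq.1, h.1 (H r hr) q hq]

lemma validIneq_preStep (he : IsCanonicalExtension e) {Γ Γ' : Set (Ineq L ℕ)}
    (h : PreStep Γ Γ') : (∀ r ∈ Γ', ValidIneq 𝔸 e r) ↔ ∀ r ∈ Γ, ValidIneq 𝔸 e r := by
  cases h with
  | mk q D hq h => exact forall_mem_replace hq (validIneq_preRule he h)

lemma validIneq_iff_validSys (e : BoundedLatticeHom A C) (q : Ineq L ℕ) :
    ValidIneq 𝔸 e q ↔ ValidSys 𝔸 e ⟨∅, q.toPlus⟩ := by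
  constructor
  · intro h val _ _
    simpa [Ineq.Holds, Ineq.toPlus, Fm.eval_toPlus] using h fun p => val (PVar.prop p)
  · intro h val
    -- No nominal or co-nominal occurs in a translated formula, so any admissible values do;
    -- elements of `A` are both closed and open.
    have := h (fun x => match x with
      | PVar.prop p => val p
      | PVar.nom _ => e ⊥
      | PVar.conom _ => e ⊤) ⟨fun _ => isClosedElt_map e _, fun _ => isOpenElt_map e _⟩ (by simp)
    simpa [Ineq.Holds, Ineq.toPlus, Fm.eval_toPlus] using this

/-- The inequality `a ≤ b` in the order of polarity `s`. -/
def Pol.ineq {M : Sig.{u}} {V : Type} (s : Pol) (t t' : Fm M V) : Ineq M V :=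
  match s with
  | pos => ⟨t, t'⟩
  | neg => ⟨t', t⟩

lemma Pol.ineq_holds {M : Sig.{u}} {V : Type} {O : Ops M C} {val : V → C} (s : Pol)
    (t t' : Fm M V) : (s.ineq t t').Holds O val ↔ s.le (t.eval O val) (t'.eval O val) := by
  cases s <;> rfl

lemma Pol.ineq_occurs {M : Sig.{u}} {V : Type} {x : V} (s : Pol) (t t' : Fm M V) :
    (s.ineq t t').Occurs x ↔ t.Occurs x ∨ t'.Occurs x := by
  cases s
  exacts [Iff.rfl, or_comm]

/-- The nominals (`pos`) and co-nominals (`neg`). -/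
def Pol.name : Pol → ℕ → PVar
  | pos => PVar.nom
  | neg => PVar.conom

lemma IsAssignment.update_name {val : PVar → C} (h : IsAssignment e val) {s : Pol} (j : ℕ) {k : C}
    (hk : s.IsClosed e k) : IsAssignment e (update val (s.name j) k) := by
  cases s <;> refine ⟨fun n => ?_, fun n => ?_⟩
  · rcases eq_or_ne n j with rfl | hn
    · simpa [Pol.name, Pol.IsClosed] using hk
    · simpa [Pol.name, hn] using h.nom n
  · simpa [Pol.name] using h.conom n
  · simpa [Pol.name] using h.nom n
  · rcases eq_or_ne n j with rfl | hn
    · simpa [Pol.name, Pol.IsClosed] using hk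
    · simpa [Pol.name, hn] using h.conom n

lemma IsAssignment.update_prop {val : PVar → C} (h : IsAssignment e val) (p : ℕ) (c : C) :
    IsAssignment e (update val (PVar.prop p) c) :=
  ⟨fun n => by simpa using h.nom n, fun n => by simpa using h.conom n⟩

lemma Ctx.occurs_fill {M : Sig.{u}} {V : Type} {c : Ctx M V} {r : Fm M V} {x : V}
    (h : r.Occurs x) : (c.fill r).Occurs x := by
  induction c with
  | hole => exact h
  | andL c t ih => exact Or.inl ih
  | andR t c ih => exact Or.inr ih
  | orL c t ih => exact Or.inl ih
  | orR t c ih => exact Or.inr ih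
  | opF f i args c ih => exact ⟨i, by simpa using ih⟩
  | opG f i args c ih => exact ⟨i, by simpa using ih⟩

/-- The approximation rules. -/
lemma validSys_approx (he : IsCanonicalExtension e) {S : Set (Ineq L.star PVar)}
    {c : Ctx L.star PVar} {γ ψ : PlusFm L} {s t : Pol} {j : ℕ} (hs : c.holeSign s = t)
    (hc : c.IsSAC s) (hb : (c.fill γ).IsBase)
    (hj : ¬ Sys.Occurs (t.name j) ⟨S, s.ineq (c.fill γ) ψ⟩) :
    ValidSys 𝔸 e ⟨S, s.ineq (c.fill γ) ψ⟩ ↔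
      ValidSys 𝔸 e ⟨S ∪ {t.ineq (Fm.var (t.name j)) γ},
        s.ineq (c.fill (Fm.var (t.name j))) ψ⟩ := by
  have hO := canOps_isComplete 𝔸 he
  subst hs
  constructor
  · intro h val hval hS
    have h1 := h val hval fun q hq => hS q (Or.inl hq)
    have h2 := hS _ (Or.inr rfl)
    rw [Pol.ineq_holds, Ctx.eval_fill] at h1 ⊢
    rw [Pol.ineq_holds] at h2
    exact Pol.le_trans (Ctx.eval_le_eval hO.toMono.star val h2) h1
  · intro h val hval hS
    simp only [Sys.Occurs, Pol.ineq_occurs, not_or, not_exists, not_and] at hj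
    obtain ⟨hjS, hjc, hjψ⟩ := hj
    -- The value of `γ` is written as the signed join of the closed elements below it, and the SAC
    -- branch carries this join outside; the bottom makes the family nonempty.
    rw [Pol.ineq_holds, Ctx.eval_fill, ← he.sup_closed (c.holeSign s) (γ.eval _ val)]
    refine Pol.le_trans (Ctx.eval_sup_le hO.toMono hO.join hO.meet val hb hc
      ⟨_, Pol.isClosed_bot e _, Pol.bot_le _ _⟩) (Pol.sup_le ?_)
    rintro _ ⟨k, ⟨hk, hkγ⟩, rfl⟩
    -- The fresh name is reinterpreted as `k`: the old premises are unaffected, and the new one says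
    -- that `k` is below `γ`.
    have h1 := h _ (hval.update_name j hk) (by
      rintro q (hq | rfl)
      · exact (Ineq.holds_update_of_not_occurs (hjS q hq) _ _).2 (hS q hq)
      · rw [Pol.ineq_holds,
          Fm.eval_update_of_not_occurs fun h' => hjc (Ctx.occurs_fill h')]
        simpa [Fm.eval] using hkγ)
    rw [Pol.ineq_holds, Ctx.eval_fill, Fm.eval_update_of_not_occurs hjψ] at h1
    dsimp only
    rw [Ctx.eval_congr (r := γ) (val' := update val ((c.holeSign s).name j) k)]
    · simpa [Fm.eval] using h1
    · intro x hx
      refine (update_of_ne ?_ _ _).symm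
      rintro rfl
      exact hjc hx

/-- Both sides of the inequality of the system consist of connectives of the original signature. -/
def Sys.IsBase (Y : Sys L) : Prop := Y.ineq.lhs.IsBase ∧ Y.ineq.rhs.IsBase

/-- Only approximation alters the inequality, and it inserts a variable; residuals enter only the
set of premises, and the Ackermann rules substitute only there. -/
lemma RedStep.isBase {Y Y' : Sys L} (h : RedStep Y Y') (hY : Y.IsBase) : Y'.IsBase := by
  induction h with
  | approxLeftPos => exact ⟨Ctx.isBase_fill hY.1 trivial, hY.2⟩
  | approxLeftNeg => exact ⟨Ctx.isBase_fill hY.1 trivial, hY.2⟩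
  | approxRightPos => exact ⟨hY.1, Ctx.isBase_fill hY.2 trivial⟩
  | approxRightNeg => exact ⟨hY.1, Ctx.isBase_fill hY.2 trivial⟩
  | residuation => exact hY
  | splitting => exact hY
  | ackermannRight => exact hY
  | ackermannLeft => exact hY

lemma validSys_redStep (he : IsCanonicalExtension e) {Y Y' : Sys L} (h : RedStep Y Y')
    (hY : Y.IsBase) : ValidSys 𝔸 e Y ↔ ValidSys 𝔸 e Y' := by
  have hO := canOps_isComplete 𝔸 he
  induction h with
  | approxLeftPos S c γ ψ j hs hc hj =>
    exact validSys_approx (s := Pol.pos) (t := Pol.pos) he hs hc hY.1 hj.1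
  | approxLeftNeg S c γ ψ m hs hc hm =>
    exact validSys_approx (s := Pol.pos) (t := Pol.neg) he hs hc hY.1 hm.1
  | approxRightPos S c γ φ j hs hc hj =>
    exact validSys_approx (s := Pol.neg) (t := Pol.pos) he hs hc hY.2 hj.1
  | approxRightNeg S c γ φ m hs hc hm =>
    exact validSys_approx (s := Pol.neg) (t := Pol.neg) he hs hc hY.2 hm.1
  | residuation S q r D hr h =>
    refine forall_congr' fun val => forall_congr' fun hval => imp_congr_left ?_
    exact (forall_mem_replace hr (hO.holds_resRule h val)).symm
  | splitting S q r D hr h =>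
    refine forall_congr' fun val => forall_congr' fun hval => imp_congr_left ?_
    exact (forall_mem_replace hr (SplitRule.holds_iff h val)).symm
  | ackermannRight p αs βγs q hα hq hβ hγ =>
    constructor
    · intro h val hval hS
      -- The letter `p` is given the value of the join of the `α`s. This satisfies all `α ≤ p`,
      -- turns the substituted premises into the original ones, and does not affect `q`.
      refine (Ineq.holds_update_of_not_occurs hq val
        ((Fm.bigOr αs).eval (canOps 𝔸 e).star val)).1 (h _ (hval.update_prop p _) ?_)
      rintro r (⟨α, hαs, rfl⟩ | hr)
      · simpa [Ineq.Holds, Fm.eval, Fm.eval_update_of_not_occurs (hα α hαs)] using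
          (Fm.eval_bigOr_le_iff (O := (canOps 𝔸 e).star)).1 le_rfl α hαs
      · exact (r.holds_subst _ _ _).1 (hS _ ⟨r, hr, rfl⟩)
    · intro h val hval hS
      refine h val hval ?_
      rintro _ ⟨r, hr, rfl⟩
      rw [Ineq.holds_subst]
      -- Conversely, the premises `α ≤ p` place the join of the `α`s below the value of `p`, and the
      -- remaining premises survive lowering `p` to that join.
      refine Ineq.Holds.of_le hO.toMono.star (hβ r hr) (hγ r hr)
        (fun y hy => update_of_ne hy _ _) ?_ (hS r (Or.inr hr))
      rw [update_self, Fm.eval_bigOr_le_iff]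
      exact fun α hαs => hS _ (Or.inl ⟨α, hαs, rfl⟩)
  | ackermannLeft p αs βγs q hα hq hβ hγ =>
    constructor
    · intro h val hval hS
      refine (Ineq.holds_update_of_not_occurs hq val
        ((Fm.bigAnd αs).eval (canOps 𝔸 e).star val)).1 (h _ (hval.update_prop p _) ?_)
      rintro r (⟨α, hαs, rfl⟩ | hr)
      · simpa [Ineq.Holds, Fm.eval, Fm.eval_update_of_not_occurs (hα α hαs)] using
          (Fm.le_eval_bigAnd_iff (O := (canOps 𝔸 e).star)).1 le_rfl α hαs
      · exact (r.holds_subst _ _ _).1 (hS _ ⟨r, hr, rfl⟩)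
    · intro h val hval hS
      refine h val hval ?_
      rintro _ ⟨r, hr, rfl⟩
      rw [Ineq.holds_subst]
      refine Ineq.Holds.of_ge hO.toMono.star (hβ r hr) (hγ r hr)
        (fun y hy => update_of_ne hy _ _) ?_ (hS r (Or.inr hr))
      rw [update_self, Fm.le_eval_bigAnd_iff]
      exact fun α hαs => hS _ (Or.inl ⟨α, hαs, rfl⟩)

lemma validSys_reflTransGen (he : IsCanonicalExtension e) {Y Y' : Sys L}
    (h : Relation.ReflTransGen RedStep Y Y') (hY : Y.IsBase) :
    (ValidSys 𝔸 e Y ↔ ValidSys 𝔸 e Y') ∧ Y'.IsBase := by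
  induction h with
  | refl => exact ⟨Iff.rfl, hY⟩
  | tail _ h ih => exact ⟨ih.1.trans (validSys_redStep he h ih.2), h.isBase ih.2⟩

lemma validIneq_reflTransGen (he : IsCanonicalExtension e) {Γ Γ' : Set (Ineq L ℕ)}
    (h : Relation.ReflTransGen PreStep Γ Γ') :
    (∀ r ∈ Γ, ValidIneq 𝔸 e r) ↔ ∀ r ∈ Γ', ValidIneq 𝔸 e r := by
  induction h with
  | refl => rfl
  | tail _ h ih => exact ih.trans (validIneq_preStep he h).symm

end Rules

end ALBA

theorem mainTheorem4 {L : ALBA.Sig.{u}} {A : Type v} {C : Type w} [Lattice A] [BoundedOrder A]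
    [CompleteLattice C] (𝔸 : ALBA.LatticeExpansion L A) (e : BoundedLatticeHom A C)
    (he : ALBA.IsCanonicalExtension e) (φ ψ : ALBA.BaseFm L) (Q : Set (ALBA.Sys L))
    (h : ALBA.Yields ⟨φ, ψ⟩ Q) :
    ALBA.ValidIneq 𝔸 e ⟨φ, ψ⟩ ↔ ∀ Y ∈ Q, ALBA.ValidSys 𝔸 e Y := by
  obtain ⟨Γ, hΓ, out, hout, rfl⟩ := h
  have hpre := ALBA.validIneq_reflTransGen (𝔸 := 𝔸) he hΓ
  simp only [Set.mem_singleton_iff, forall_eq] at hpre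
  rw [hpre, Set.forall_mem_image]
  refine forall₂_congr fun r hr => ?_
  exact (ALBA.validIneq_iff_validSys e r).trans (ALBA.validSys_reflTransGen he (hout r hr).1
    ⟨r.lhs.isBase_toPlus, r.rhs.isBase_toPlus⟩).1
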